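/- Let $M$ be an $n$-dimensional semisimple Frobenius manifold, $n\ge 1$, given by a simply connected domain in $\mathbb C^n$ (for example a ball) with flat coordinates $v^1,\dots,v^n$, $e=\partial/\partial v^1$: a constant symmetric nondegenerate metric $(\eta_{\alpha\beta})$ with inverse $(\eta^{\alpha\beta})$, a holomorphic potential $F(v)$ with $\partial_1\partial_\alpha\partial_\beta F=\eta_{\alpha\beta}$ satisfying the associativity equations, so that $c^\gamma_{\alpha\beta}=\eta^{\gamma\varepsilon}\partial_\varepsilon\partial_\alpha\partial_\beta F$ are the structure constants of an algebra on $T_vM$, semisimple for generic $v$, and a linear (i.e. affine in $v$) Euler vector field $E$ with $[e,E]=e$ and $\partial_EF=(3-d)F+\text{quadratic}$ for a constant $d$. Put $\mathcal V=\frac{2-d}{2}-\nabla E$, let $\mathcal U(v)$ be the operator of multiplication by $E(v)$ on $T_vM$, and denote by $A^*$ the adjoint of a matrix $A$ with respect to $\eta$. Let $\theta_\alpha(v;z)=\sum_{p\ge 0}\theta_{\alpha,p}(v)z^p$, $\alpha=1,\dots,n$, be the series of a Levelt system of deformed flat coordinates $(\theta_1,\dots,\theta_n)z^{\hat\mu}z^R$.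 That is, $\mathcal V=\hat\mu+R_0$ with $\hat\mu$ semisimple and $R_0$ nilpotent, $R=R_0+R_1+\cdots$ with $[\hat\mu,R_k]=kR_k$ and $R_k^*=(-1)^{k+1}R_k$; the functions $\theta_{\alpha,p}$ are holomorphic on $M$ with $$\theta_{\alpha,0}=\eta_{\alpha\varepsilon}v^\varepsilon,\qquad \partial_\lambda\partial_\mu\theta_{\alpha,p+1}=c^\nu_{\lambda\mu}\,\partial_\nu\theta_{\alpha,p}\quad(p\ge 0),$$ and the matrices $\Theta_p=(\eta^{\alpha\varepsilon}\partial_\varepsilon\theta_{\beta,p})$ satisfy $$(p+1)\Theta_{p+1}+[\Theta_{p+1},\mathcal V]=\mathcal U\,\Theta_p-\sum_{k\ge 1}\Theta_{p-k+1}R_k\quad(p\ge 0),$$ where $\Theta_q=0$ for $q<0$, and $\sum_{k=0}^{p}(-1)^k\Theta_k^*\Theta_{p-k}=0$ for $p\ge 1$. Let $h=h(v;v_x,\dots,v^{(m)})$ be a differential polynomial, i.e. a polynomial in the jet variables $v^{\alpha,s}=\partial_x^s v^\alpha$, $s\ge 1$, with coefficients holomorphic on $M$. Assume that $I=\int h\,dx$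 is a conservation law of the Principal Hierarchy, i.e. for all $\alpha$ and all $p\ge 0$ $$\{I,\bar\theta_{\alpha,p}\}_1=\int \frac{\delta I}{\delta v^\beta(x)}\,\eta^{\beta\gamma}\,\partial_x\frac{\delta\bar\theta_{\alpha,p}}{\delta v^\gamma(x)}\,dx=0,\qquad \bar\theta_{\alpha,p}=\int\theta_{\alpha,p}(v)\,dx,$$ where a local functional $\int f\,dx$ is zero if $f$ is the total $x$-derivative of a differential polynomial plus a constant. Assume also that $h$ is polynomial in $v^1$, i.e. a finite sum $\sum_k (v^1)^k h_k$ with differential polynomials $h_k$ such that $\partial h_k/\partial v^1=0$. Then $$h=\sum_{\alpha,p}c^{\alpha,p}\,\theta_{\alpha,p}(v)+\partial_x g+\mathrm{const}$$ for some differential polynomial $g$ and some constants $c^{\alpha,p}$, only finitely many of which are nonzero. -/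

import Mathlib

open scoped ContDiff

noncomputable section

namespace PrincipalHierarchy

open TopologicalSpace (Opens)

/-! ### Holomorphic functions on a domain in the space of flat coordinates -/

/-- A function on the open set `U ⊆ ℂⁿ` is holomorphic if it is complex-smooth. The extension by
zero is only used to speak of derivatives; on the open set `U` they do not depend on it. -/
def IsHol {n : ℕ} (U : Opens (Fin n → ℂ)) (f : U → ℂ) : Prop :=
  ContDiffOn ℂ ∞ (Function.extend Subtype.val f 0) (U : Set (Fin n → ℂ))

theorem extend_coe {n : ℕ} {U : Opens (Fin n → ℂ)} (f : U → ℂ) {x : Fin n → ℂ} (hx : x ∈ U) :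
    Function.extend Subtype.val f 0 x = f ⟨x, hx⟩ :=
  Subtype.val_injective.extend_apply f 0 ⟨x, hx⟩

/-- A restriction to `U` of a function that is complex-smooth on `U` is holomorphic. -/
theorem IsHol.of_contDiffOn {n : ℕ} {U : Opens (Fin n → ℂ)} {f : U → ℂ} (g : (Fin n → ℂ) → ℂ)
    (hg : ContDiffOn ℂ ∞ g U) (hfg : ∀ x : U, f x = g x) : IsHol U f :=
  hg.congr fun x hx => by rw [extend_coe f hx, hfg ⟨x, hx⟩]

/-- The algebra `𝒪(U)` of holomorphic functions on `U`. -/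
def Hol {n : ℕ} (U : Opens (Fin n → ℂ)) : Subalgebra ℂ (U → ℂ) where
  carrier := {f | IsHol U f}
  mul_mem' {f g} hf hg := IsHol.of_contDiffOn
    (fun x => Function.extend Subtype.val f 0 x * Function.extend Subtype.val g 0 x)
    (ContDiffOn.mul hf hg) fun x => by simp
  add_mem' {f g} hf hg := IsHol.of_contDiffOn
    (fun x => Function.extend Subtype.val f 0 x + Function.extend Subtype.val g 0 x)
    (ContDiffOn.add hf hg) fun x => by simp
  algebraMap_mem' a := IsHol.of_contDiffOn (fun _ => a) contDiffOn_const fun _ => rfl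

/-- The partial derivative `∂f/∂v^α` of a function on `U`, at the points of `U`. -/
def partialFun {n : ℕ} {U : Opens (Fin n → ℂ)} (α : Fin n) (f : U → ℂ) : U → ℂ :=
  fun x => fderiv ℂ (Function.extend Subtype.val f 0) x (Pi.single α 1)

theorem partialFun_isHol {n : ℕ} {U : Opens (Fin n → ℂ)} (α : Fin n) (f : U → ℂ)
    (hf : IsHol U f) : IsHol U (partialFun α f) :=
  IsHol.of_contDiffOn
    (fun x => fderiv ℂ (Function.extend Subtype.val f 0) x (Pi.single α 1))
    ((hf.fderiv_of_isOpen (m := ∞) U.isOpen (by simp)).clm_apply contDiffOn_const) fun _ => rfl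

/-- The partial derivative `∂_α = ∂/∂v^α : 𝒪(U) → 𝒪(U)`. -/
def pd {n : ℕ} {U : Opens (Fin n → ℂ)} (α : Fin n) (f : Hol U) : Hol U :=
  ⟨partialFun α f.1, partialFun_isHol α f.1 f.2⟩

/-- The coordinate function `v^α` on `U`. -/
def coord {n : ℕ} {U : Opens (Fin n → ℂ)} (α : Fin n) : Hol U :=
  ⟨fun x => x.1 α, IsHol.of_contDiffOn (fun x => x α) (contDiff_apply ℂ ℂ α).contDiffOn
    fun _ => rfl⟩

/-- A constant matrix as a matrix of functions on `U`. -/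
def constMatrix {n : ℕ} (U : Opens (Fin n → ℂ)) (A : Matrix (Fin n) (Fin n) ℂ) :
    Matrix (Fin n) (Fin n) (Hol U) :=
  A.map (algebraMap ℂ (Hol U))

/-! ### Frobenius manifolds in flat coordinates -/

/-- An `n`-dimensional Frobenius manifold structure on a domain `U ⊆ ℂⁿ` of flat coordinates
`v^1, …, v^n` (indexed by `Fin n`; the coordinate called `v^1` has index `0`): a nondegenerate
constant metric `η`, a potential `F` solving the associativity equations with constant unity field
`e = ∂/∂v^1`, and a linear Euler vector field `E^α(v) = Q^α_β v^β + r^α` such that `[e, E] = e` and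
`∂_E F = (3 - d) F + quadratic`. -/
structure FrobeniusManifold (n : ℕ) [NeZero n] (U : Opens (Fin n → ℂ)) where
  /-- the matrix `η_{αβ} = ⟨∂_α, ∂_β⟩` -/
  η : Matrix (Fin n) (Fin n) ℂ
  η_symm : η.IsSymm
  η_nondeg : IsUnit η.det
  /-- the potential -/
  F : Hol U
  unity : ∀ α β, pd 0 (pd α (pd β F)) = algebraMap ℂ (Hol U) (η α β)
  assoc : ∀ α β γ δ,
    ∑ l, ∑ m, η⁻¹ l m • (pd α (pd β (pd l F)) * pd m (pd γ (pd δ F))) =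
      ∑ l, ∑ m, η⁻¹ l m • (pd δ (pd β (pd l F)) * pd m (pd γ (pd α F)))
  /-- the linear part of the Euler vector field, that is, the matrix of `∇E` -/
  Q : Matrix (Fin n) (Fin n) ℂ
  /-- the constant part of the Euler vector field -/
  r : Fin n → ℂ
  /-- the charge -/
  d : ℂ
  /-- `[e, E] = e` -/
  euler_unity : ∀ α, Q α 0 = if α = 0 then 1 else 0
  /-- `∂_E F = (3 - d) F + quadratic` -/
  euler_potential : ∃ (A : Matrix (Fin n) (Fin n) ℂ) (b : Fin n → ℂ) (k : ℂ),
    ∑ α, (∑ β, Q α β • coord β + algebraMap ℂ (Hol U) (r α)) * pd α F =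
      (3 - d) • F + (∑ α, ∑ β, A α β • (coord α * coord β) + ∑ α, b α • coord α
        + algebraMap ℂ (Hol U) k)

namespace FrobeniusManifold

variable {n : ℕ} [NeZero n] {U : Opens (Fin n → ℂ)} (M : FrobeniusManifold n U)

/-- The components `E^α` of the Euler vector field. -/
def euler (α : Fin n) : Hol U :=
  ∑ β, M.Q α β • coord β + algebraMap ℂ (Hol U) (M.r α)

/-- The structure functions `c^γ_{αβ}(v) = η^{γε} ∂_ε ∂_α ∂_β F(v)`. -/
def c (γ α β : Fin n) : Hol U :=
  ∑ ε, M.η⁻¹ γ ε • pd ε (pd α (pd β M.F))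

/-- The product `a · b` of the algebra `T_vM`, in components. -/
def mul (v : U) (a b : Fin n → ℂ) : Fin n → ℂ :=
  fun γ => ∑ α, ∑ β, (M.c γ α β).1 v * a α * b β

/-- The algebra `T_vM` is semisimple: it has a basis of pairwise orthogonal idempotents. -/
def IsSemisimpleAt (v : U) : Prop :=
  ∃ π : Module.Basis (Fin n) ℂ (Fin n → ℂ),
    ∀ i j, M.mul v (π i) (π j) = if i = j then π i else 0

/-- `M` is semisimple: the algebras `T_vM` are semisimple for generic `v`. -/
def IsSemisimple : Prop :=
  Dense {v : U | M.IsSemisimpleAt v}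

/-- The matrix `𝒰^α_β = E^ε c^α_{εβ}` of multiplication by the Euler vector field. -/
def eulerMul : Matrix (Fin n) (Fin n) (Hol U) :=
  Matrix.of fun α β => ∑ ε, M.euler ε * M.c α ε β

/-- The matrix `𝒱 = (2 - d)/2 - ∇E`. -/
def calV : Matrix (Fin n) (Fin n) ℂ :=
  ((2 - M.d) / 2) • (1 : Matrix (Fin n) (Fin n) ℂ) - M.Q

/-- The adjoint `A^* = η⁻¹ Aᵀ η` of a constant matrix with respect to the metric. -/
def adj (A : Matrix (Fin n) (Fin n) ℂ) : Matrix (Fin n) (Fin n) ℂ :=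
  M.η⁻¹ * A.transpose * M.η

/-- The adjoint with respect to the metric of a matrix of functions. -/
def adjHol (A : Matrix (Fin n) (Fin n) (Hol U)) : Matrix (Fin n) (Fin n) (Hol U) :=
  constMatrix U M.η⁻¹ * A.transpose * constMatrix U M.η

/-- The matrix `Θ^α_β = η^{αε} ∂_ε θ_β` whose columns are the gradients of the functions `θ_β`. -/
def gradMatrix (θ : Fin n → Hol U) : Matrix (Fin n) (Fin n) (Hol U) :=
  Matrix.of fun α β => ∑ ε, M.η⁻¹ α ε • pd ε (θ β)

end FrobeniusManifold

/-- A choice of Levelt system of deformed flat coordinates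
`(θ_1(v; z), …, θ_n(v; z)) z^μ z^R` of the Frobenius manifold at `z = 0`, where
`θ_α(v; z) = ∑ₚ θ_{α,p}(v) z^p`: the monodromy data `μ`, `R = R_0 + R_1 + …` and the coefficients
`θ_{α,p}`. With `Θ(v; z) = ∑ₚ Θ_p(v) z^p` the matrix of gradients, the last conditions are the
expansions in `z` of `∂_α Y = z C_α Y`, of `∂_z Y = (𝒰 + 𝒱 / z) Y` for `Y = Θ z^μ z^R`, and of
`Θ^*(v; -z) Θ(v; z) = 1`. -/
structure LeveltSystem {n : ℕ} [NeZero n] {U : Opens (Fin n → ℂ)}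
    (M : FrobeniusManifold n U) where
  /-- the semisimple part of `𝒱` -/
  μ : Matrix (Fin n) (Fin n) ℂ
  /-- the components `R_0, R_1, …` of `R`, where `R_0` is the nilpotent part of `𝒱` -/
  R : ℕ → Matrix (Fin n) (Fin n) ℂ
  μ_semisimple : Module.End.IsSemisimple (Matrix.toLin' μ)
  R_zero_nilpotent : IsNilpotent (R 0)
  calV_eq : M.calV = μ + R 0
  R_grading : ∀ k, μ * R k - R k * μ = (k : ℂ) • R k
  R_adj : ∀ k, M.adj (R k) = (-1 : ℂ) ^ (k + 1) • R k
  /-- the functions `θ_{α,p}` -/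
  θ : Fin n → ℕ → Hol U
  /-- `θ_{α,0} = v_α = η_{αε} v^ε` -/
  θ_zero : ∀ α, θ α 0 = ∑ ε, M.η α ε • coord ε
  /-- `∂_λ ∂_μ θ_{α,p+1} = c^ν_{λμ} ∂_ν θ_{α,p}` -/
  θ_succ : ∀ α p l m, pd l (pd m (θ α (p + 1))) = ∑ ν, M.c ν l m * pd ν (θ α p)
  /-- `(p+1) Θ_{p+1} + [Θ_{p+1}, 𝒱] = 𝒰 Θ_p - ∑_{k ≥ 1} Θ_{p-k+1} R_k` -/
  Θ_succ : ∀ p : ℕ,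
    ((p : ℂ) + 1) • M.gradMatrix (fun α => θ α (p + 1))
      + (M.gradMatrix (fun α => θ α (p + 1)) * constMatrix U M.calV
        - constMatrix U M.calV * M.gradMatrix (fun α => θ α (p + 1))) =
    M.eulerMul * M.gradMatrix (fun α => θ α p)
      - ∑ k ∈ Finset.Icc 1 (p + 1),
          M.gradMatrix (fun α => θ α (p + 1 - k)) * constMatrix U (R k)
  /-- `Θ^*(v; -z) Θ(v; z) = 1`; the constant term of this identity is automatic -/
  Θ_orthogonal : ∀ p : ℕ,
    ∑ k ∈ Finset.range (p + 2),
      (-1 : ℂ) ^ k • (M.adjHol (M.gradMatrix fun α => θ α k)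
        * M.gradMatrix fun α => θ α (p + 1 - k)) = 0

/-! ### Differential polynomials and local functionals -/

/-- The ring `𝒜` of differential polynomials `h(v; v_x, v_xx, …)` on `U`: polynomials in the jet
variables `v^{α,s}`, `s ≥ 1`, with coefficients in `𝒪(U)`. The variable `X (α, s)` stands for
`v^{α,s+1}`. -/
abbrev DiffPoly {n : ℕ} (U : Opens (Fin n → ℂ)) : Type :=
  MvPolynomial (Fin n × ℕ) (Hol U)

section DiffPoly

variable {n : ℕ} {U : Opens (Fin n → ℂ)}

/-- A function on `U` as a differential polynomial. -/
def ofFun (f : Hol U) : DiffPoly U := MvPolynomial.C f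

/-- A constant as a differential polynomial. -/
def ofConst (k : ℂ) : DiffPoly U := ofFun (algebraMap ℂ (Hol U) k)

/-- The partial derivative `∂/∂v^α` of differential polynomials, acting on the coefficients. -/
def coeffPd (α : Fin n) (f : DiffPoly U) : DiffPoly U :=
  ∑ m ∈ f.support, MvPolynomial.monomial m (pd α (f.coeff m))

/-- The partial derivative `∂/∂v^{α,s}`, where `v^{α,0} = v^α`. -/
def jetPd (α : Fin n) : ℕ → DiffPoly U → DiffPoly U
  | 0, f => coeffPd α f
  | s + 1, f => MvPolynomial.pderiv (α, s) f

/-- The total derivative `∂_x f = ∑_{α, s ≥ 0} v^{α,s+1} ∂f/∂v^{α,s}`. -/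
def totalDeriv (f : DiffPoly U) : DiffPoly U :=
  ∑ α, MvPolynomial.X (α, 0) * jetPd α 0 f
    + ∑ j ∈ f.vars, MvPolynomial.X (j.1, j.2 + 1) * jetPd j.1 (j.2 + 1) f

/-- The largest `s` such that `v^{α,s}` occurs in `f` for some `α`, or `0` if there is none. -/
def jetOrder (f : DiffPoly U) : ℕ :=
  f.vars.sup fun j => j.2 + 1

/-- The variational derivative `δf̄/δv^α(x) = ∑ₛ (-1)^s ∂_x^s (∂f/∂v^{α,s})` of `f̄ = ∫ f dx`; the
terms with `s > jetOrder f` vanish. -/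
def varDeriv (α : Fin n) (f : DiffPoly U) : DiffPoly U :=
  ∑ s ∈ Finset.range (jetOrder f + 1), (-1) ^ s * totalDeriv^[s] (jetPd α s f)

/-- The density `f` defines the zero local functional `∫ f dx`: it is a total derivative of a
differential polynomial plus a constant (densities are considered modulo constants). -/
def IsZeroFunctional (f : DiffPoly U) : Prop :=
  ∃ (g : DiffPoly U) (k : ℂ), f = totalDeriv g + ofConst k

/-- `h` is polynomial in `v^1`: it is a finite sum of terms `(v^1)^k h_k` with differential
polynomials `h_k` that do not depend on `v^1` (they may depend on `v^1_x, v^1_xx, …`). -/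
def IsPolynomialInFirst [NeZero n] (h : DiffPoly U) : Prop :=
  ∃ (N : ℕ) (a : ℕ → DiffPoly U), (∀ k, coeffPd 0 (a k) = 0) ∧
    h = ∑ k ∈ Finset.range N, ofFun (coord 0) ^ k * a k

end DiffPoly

/-- The density `(δf̄/δv^α) η^{αβ} ∂_x (δḡ/δv^β)` of the first Poisson bracket `{f̄, ḡ}_1`, where
`{v^α(x), v^β(y)}_1 = η^{αβ} δ'(x - y)`. -/
def bracketDensity {n : ℕ} [NeZero n] {U : Opens (Fin n → ℂ)} (M : FrobeniusManifold n U)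
    (f g : DiffPoly U) : DiffPoly U :=
  ∑ α, ∑ β, ofConst (M.η⁻¹ α β) * (varDeriv α f * totalDeriv (varDeriv β g))

/-- `I = ∫ h dx` is a conservation law of the Principal Hierarchy: `{I, θ̄_{α,p}}_1 = 0` for all
`α` and all `p ≥ 0`. -/
def IsConservationLaw {n : ℕ} [NeZero n] {U : Opens (Fin n → ℂ)} {M : FrobeniusManifold n U}
    (L : LeveltSystem M) (h : DiffPoly U) : Prop :=
  ∀ (α : Fin n) (p : ℕ), IsZeroFunctional (bracketDensity M h (ofFun (L.θ α p)))

end PrincipalHierarchy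

end

/-! ### Gluing on a simply connected space. -/

open scoped ContDiff

noncomputable section

/-! Write C_μ for multiplication by ∂_μ, C_{v_x} for multiplication by v_x, w for the variational
gradient of I with its index raised by η, and ξ_a(z) = ∑_q dθ_{a,q} z^q. The recursion for the θ's
reads ∂_μ ξ_a = z C_μᵀ ξ_a, so the density of {I, θ̄_{a,q+1}} is the z^q-coefficient of ⟨Q, ξ_a(z)⟩
with Q = C_{v_x} w. A zero functional has zero variational derivatives, and ∂_x⟨S, ξ_a⟩ = ⟨(∂_x + z
C_{v_x}) S, ξ_a⟩. Hence the variational derivative in the direction μ is ⟨Z, ξ_a⟩ with Z = z C_μ Q +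
∑_s (-(∂_x + z C_{v_x}))^s ∂Q/∂v^{μ,s}. Since the covectors ξ_{a,0} are constant and form a basis, Z
= 0.

The powers of z are now compared. Multiplication by v_x is injective because its coefficient at the
first jet of the unit coordinate is the identity. The coefficients of z^s, s ≥ 2, taken in
descending order, give ∂Q/∂v^{μ,s} = 0. The coefficient of z gives C_μ Q = C_{v_x} ∂Q/∂v^{μ,1},
which, as Q = C_{v_x} w and multiplication is commutative, becomes C_{v_x}² ∂w/∂v^{μ,1} = 0. So w is
a function of v alone, and the constant coefficient yields ∂_μ w = C_μ ∂_1 w. This is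
`eq_C_of_varDer_pairing_eq_zero`.

The gradient of I therefore equals df, where f is the jet-free part of h. By
`exists_eq_total_add_const_of_varDer_eq_zero`, h - f is a total derivative plus a constant; this is
where simple connectedness enters, through the Poincaré lemma. Moreover ∂_λ∂_μ f = c^ν_{λμ} ∂_ν∂_1
f, and polynomiality in v^1 means that some power of ∂_1 kills f. Induction on that power
(`exists_mem_span_of_pde`) puts f in the span of the θ_{α,p} and the constants: the step from ∂_1 f
to f is the shift p → p + 1, up to an affine function. -/

/-- Local functions that differ by locally constant functions glue, up to locally constant
functions, on a simply connected space. -/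
theorem exists_glue_of_locallyConstant_sub {X G : Type*} [TopologicalSpace X]
    [SimplyConnectedSpace X] [LocallyPathConnectedSpace X] [AddCommGroup G]
    (V : X → Set X) (hV : ∀ x, IsOpen (V x)) (hmem : ∀ x, x ∈ V x) (F : X → X → G)
    (hF : ∀ x y, ∀ z ∈ V x ∩ V y, ∀ᶠ w in nhds z, F x w - F y w = F x z - F y z) :
    ∃ f : X → G, ∀ x, ∀ z ∈ V x, ∀ᶠ w in nhds z, f w - F x w = f z - F x z := by
  let _ : TopologicalSpace G := ⊥
  have : DiscreteTopology G := ⟨rfl⟩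
  -- Fibre bundle with discrete fibre whose coordinate v_i in the chart i is such that v_i + F_i
  -- does not depend on i. The transition maps are continuous because F_i - F_j is locally constant.
  -- It is a covering, so simple connectedness provides a section.
  let Z : FiberBundleCore X X G :=
    { baseSet := V
      isOpen_baseSet := hV
      indexAt := id
      mem_baseSet_at := hmem
      coordChange := fun i j x v => v + (F i x - F j x)
      coordChange_self := fun i x _ v => by simp
      continuousOn_coordChange := fun i j => by
        rintro ⟨z, v⟩ ⟨hz, -⟩
        refine ContinuousAt.continuousWithinAt ?_
        have h1 : ∀ᶠ p : X × G in nhds (z, v), F i p.1 - F j p.1 = F i z - F j z :=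
          (continuous_fst.tendsto (z, v)).eventually (hF i j z hz)
        have h2 : ∀ᶠ p : X × G in nhds (z, v), p.2 = v :=
          (continuous_snd.tendsto (z, v)).eventually (IsOpen.mem_nhds (isOpen_discrete {v}) rfl)
        have h3 : (fun p : X × G => p.2 + (F i p.1 - F j p.1)) =ᶠ[nhds (z, v)]
            fun _ => v + (F i z - F j z) := by
          filter_upwards [h1, h2] with p hp hp'
          rw [hp, hp']
        exact continuousAt_const.congr h3.symm
      coordChange_comp := fun i j k x _ v => by abel }
  have hcov : IsCoveringMap (Bundle.TotalSpace.proj : Bundle.TotalSpace G Z.Fiber → X) :=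
    FiberBundle.isCoveringMap
  obtain ⟨x₀⟩ : Nonempty X := inferInstance
  obtain ⟨s, ⟨-, hs⟩, -⟩ := hcov.existsUnique_continuousMap_lifts (ContinuousMap.id X) x₀
    (⟨x₀, (0 : G)⟩ : Bundle.TotalSpace G Z.Fiber) rfl
  have hs' : ∀ x, (s x).proj = x := fun x => congrFun hs x
  -- The fibre over x is stored in the chart with index x, hence the term F x x. In the chart i the
  -- section has coordinate f - F_i, which is locally constant by continuity.
  refine ⟨fun x => id (α := G) (s x).snd + F x x, fun i z hz => ?_⟩
  have hsnd : ∀ w, (Z.localTriv i (s w)).2 = id (α := G) (s w).snd + F w w - F i w := by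
    intro w
    have : (Z.localTriv i (s w)).2 =
        id (α := G) (s w).snd + (F (s w).proj (s w).proj - F i (s w).proj) := rfl
    rw [this, hs' w]
    abel
  have hcont : ContinuousAt (fun w => (Z.localTriv i (s w)).2) z := by
    have h1 : ContinuousAt (Z.localTriv i) (s z) :=
      (Z.localTriv i).continuousAt (by
        rw [(Z.localTriv i).mem_source]
        change (s z).proj ∈ V i
        rw [hs' z]
        exact hz)
    exact continuousAt_snd.comp (h1.comp s.continuous.continuousAt)
  have h2 : ∀ᶠ w in nhds z, (Z.localTriv i (s w)).2 = (Z.localTriv i (s z)).2 :=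
    hcont.eventually (IsOpen.mem_nhds (isOpen_discrete {_}) rfl)
  filter_upwards [h2] with w hw
  rw [hsnd, hsnd] at hw
  exact hw

/-! ### Holomorphic functions: partial derivatives and the Poincaré lemma. -/

namespace PrincipalHierarchy

open TopologicalSpace (Opens)

section Hol

variable {n : ℕ} {U : Opens (Fin n → ℂ)}

theorem differentiableAt_extend (f : Hol U) {x : Fin n → ℂ} (hx : x ∈ U) :
    DifferentiableAt ℂ (Function.extend Subtype.val f.1 0) x :=
  (f.2.contDiffAt (U.isOpen.mem_nhds hx)).differentiableAt (by simp)

/-- A function on the ambient space that agrees with `f` on `U` has the same derivative. -/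
theorem fderiv_extend_eq (f : U → ℂ) (g : (Fin n → ℂ) → ℂ) (hfg : ∀ x : U, f x = g x) (x : U) :
    fderiv ℂ (Function.extend Subtype.val f 0) x = fderiv ℂ g x := by
  refine Filter.EventuallyEq.fderiv_eq ?_
  filter_upwards [U.isOpen.mem_nhds x.2] with y hy
  rw [extend_coe f hy, hfg]

theorem pd_val (α : Fin n) (f : Hol U) (x : U) :
    (pd α f).1 x = fderiv ℂ (Function.extend Subtype.val f.1 0) x (Pi.single α 1) := rfl

theorem pd_add (α : Fin n) (f g : Hol U) : pd α (f + g) = pd α f + pd α g := by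
  refine Subtype.ext (funext fun x => ?_)
  rw [pd_val, fderiv_extend_eq (f + g).1
    (Function.extend Subtype.val f.1 0 + Function.extend Subtype.val g.1 0)
    (fun y => by simp), fderiv_add (differentiableAt_extend f x.2)
      (differentiableAt_extend g x.2)]
  rfl

theorem pd_algebraMap (α : Fin n) (k : ℂ) : pd α (algebraMap ℂ (Hol U) k) = 0 := by
  refine Subtype.ext (funext fun x => ?_)
  rw [pd_val, fderiv_extend_eq (algebraMap ℂ (Hol U) k).1 (fun _ => k) (fun y => rfl)]
  simp

theorem pd_mul (α : Fin n) (f g : Hol U) : pd α (f * g) = f * pd α g + g * pd α f := by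
  refine Subtype.ext (funext fun x => ?_)
  rw [pd_val, fderiv_extend_eq (f * g).1
    (Function.extend Subtype.val f.1 0 * Function.extend Subtype.val g.1 0)
    (fun y => by simp), fderiv_mul (differentiableAt_extend f x.2)
      (differentiableAt_extend g x.2)]
  simp [pd_val]

/-- The partial derivative as a derivation. -/
def pdDer (α : Fin n) : Derivation ℂ (Hol U) (Hol U) :=
  Derivation.mk'
    { toFun := pd α
      map_add' := pd_add α
      map_smul' := fun k f => by
        simp only [Algebra.smul_def, pd_mul, pd_algebraMap, mul_zero, add_zero, RingHom.id_apply] }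
    fun f g => by simp [pd_mul]

@[simp] theorem pdDer_apply (α : Fin n) (f : Hol U) : pdDer α f = pd α f := rfl

theorem pd_coord (α β : Fin n) :
    pd α (coord β : Hol U) = algebraMap ℂ (Hol U) (if α = β then 1 else 0) := by
  refine Subtype.ext (funext fun x => ?_)
  rw [pd_val, fderiv_extend_eq (coord β : Hol U).1 (fun y => y β) (fun y => rfl)]
  rw [show (fun y : Fin n → ℂ => y β) = (ContinuousLinearMap.proj β : (Fin n → ℂ) →L[ℂ] ℂ) from rfl,
    ContinuousLinearMap.fderiv]
  rw [ContinuousLinearMap.proj_apply, Pi.single_apply]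
  simp only [eq_comm (a := β)]
  rfl

theorem pd_comm (α β : Fin n) (f : Hol U) : pd α (pd β f) = pd β (pd α f) := by
  refine Subtype.ext (funext fun x => ?_)
  have hf := f.2.contDiffAt (U.isOpen.mem_nhds x.2)
  have hd : DifferentiableAt ℂ (fderiv ℂ (Function.extend Subtype.val f.1 0)) x :=
    (hf.fderiv_right (m := 1) (by norm_cast)).differentiableAt (by simp)
  have key : ∀ a b : Fin n, (pd a (pd b f)).1 x =
      fderiv ℂ (fderiv ℂ (Function.extend Subtype.val f.1 0)) x (Pi.single a 1)
        (Pi.single b 1) := by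
    intro a b
    rw [pd_val, fderiv_extend_eq (pd b f).1
      (fun y => fderiv ℂ (Function.extend Subtype.val f.1 0) y (Pi.single b 1)) (fun y => rfl)]
    rw [fderiv_clm_apply hd (by fun_prop)]
    simp
  rw [key, key]
  exact (hf.isSymmSndFDerivAt (by simp [ENat.LEInfty.out])) _ _

theorem fderiv_extend_apply (f : Hol U) (x : U) (y : Fin n → ℂ) :
    fderiv ℂ (Function.extend Subtype.val f.1 0) x y = ∑ α, y α * (pd α f).1 x := by
  conv_lhs => rw [← Finset.univ_sum_single y]
  rw [map_sum]
  refine Finset.sum_congr rfl fun α _ => ?_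
  rw [show (Pi.single α (y α) : Fin n → ℂ) = y α • Pi.single α 1 by
    rw [← Pi.single_smul]; simp, map_smul, smul_eq_mul, pd_val]

theorem exists_eq_algebraMap_of_pd_eq_zero [PreconnectedSpace U] [Nonempty U] (f : Hol U)
    (hf : ∀ α, pd α f = 0) : ∃ k, f = algebraMap ℂ (Hol U) k := by
  obtain ⟨x₀⟩ : Nonempty U := inferInstance
  have hpre : IsPreconnected (U : Set (Fin n → ℂ)) :=
    isPreconnected_iff_preconnectedSpace.2 inferInstance
  refine ⟨f.1 x₀, Subtype.ext (funext fun x => ?_)⟩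
  have h := U.isOpen.is_const_of_fderiv_eq_zero (𝕜 := ℂ) hpre
    (f := Function.extend Subtype.val f.1 0)
    (fun y hy => (differentiableAt_extend f hy).differentiableWithinAt) (fun y hy => by
      ext z
      have := fderiv_extend_apply f ⟨y, hy⟩ z
      simpa [hf] using this) x.2 x₀.2
  rw [extend_coe _ x.2, extend_coe _ x₀.2] at h
  exact h

/-- A closed holomorphic one-form on a simply connected domain is exact. -/
theorem exists_pd_eq_of_closed [SimplyConnectedSpace U] (κ : Fin n → Hol U)
    (hκ : ∀ α β, pd α (κ β) = pd β (κ α)) : ∃ f : Hol U, ∀ α, pd α f = κ α := by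
  -- The one-form ∑ κ_β dv^β as a map to covectors; closedness is symmetry of its derivative.
  let W : (Fin n → ℂ) → (Fin n → ℂ) →L[ℂ] ℂ := fun y =>
    ∑ β, Function.extend Subtype.val (κ β).1 0 y • ContinuousLinearMap.proj β
  have hW : ContDiffOn ℂ ∞ W U :=
    ContDiffOn.sum fun β _ => ContDiffOn.smul (κ β).2 contDiffOn_const
  have hWd : ∀ x ∈ U, DifferentiableAt ℂ W x := fun x hx =>
    (hW.contDiffAt (U.isOpen.mem_nhds hx)).differentiableAt (by simp)
  have hWs : ∀ x : U, ∀ y z, fderiv ℂ W x y z = ∑ β, ∑ α, y α * (pd α (κ β)).1 x * z β := by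
    intro x y z
    have h1 : fderiv ℂ W x y z = fderiv ℂ (fun p => W p z) x y := by
      rw [fderiv_clm_apply (hWd x x.2) (by fun_prop)]
      simp
    have h2 : (fun p => W p z) =
        fun p => ∑ β, Function.extend Subtype.val (κ β).1 0 p * z β := by
      funext p
      simp [W]
    rw [h1, h2, fderiv_fun_sum fun β _ => (differentiableAt_extend (κ β) x.2).mul_const _]
    rw [_root_.sum_apply]
    refine Finset.sum_congr rfl fun β _ => ?_
    rw [fderiv_mul_const (differentiableAt_extend (κ β) x.2), _root_.smul_apply,
      fderiv_extend_apply, smul_eq_mul, mul_comm, Finset.sum_mul]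
  have hsymm : ∀ x ∈ U, ∀ y z, fderiv ℂ W x y z = fderiv ℂ W x z y := by
    intro x hx y z
    rw [hWs ⟨x, hx⟩, hWs ⟨x, hx⟩, Finset.sum_comm]
    refine Finset.sum_congr rfl fun α _ => Finset.sum_congr rfl fun β _ => ?_
    rw [hκ]
    ring
  have hball : ∀ x : U, ∃ r > 0, Metric.ball (x : Fin n → ℂ) r ⊆ U := fun x =>
    Metric.isOpen_iff.1 U.isOpen x x.2
  choose r hr hrU using hball
  -- Primitives exist on balls by convexity. On overlaps they differ by locally constant functions,
  -- so they glue.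
  have hprim : ∀ x : U, ∃ f : (Fin n → ℂ) → ℂ, ∀ a ∈ Metric.ball (x : Fin n → ℂ) (r x),
      HasFDerivAt f (W a) a := by
    intro x
    refine (convex_ball _ _).exists_forall_hasFDerivAt_of_fderiv_symmetric Metric.isOpen_ball
      (fun a ha => ((hWd a (hrU x ha)).restrictScalars ℝ).differentiableWithinAt) ?_
    intro a ha y z
    rw [(hWd a (hrU x ha)).fderiv_restrictScalars ℝ]
    exact hsymm a (hrU x ha) y z
  choose F hF using hprim
  have : LocallyPathConnectedSpace U := U.isOpen.locallyPathConnectedSpace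
  obtain ⟨f, hf⟩ := exists_glue_of_locallyConstant_sub (X := U) (G := ℂ)
    (fun x => Subtype.val ⁻¹' Metric.ball (x : Fin n → ℂ) (r x))
    (fun x => Metric.isOpen_ball.preimage continuous_subtype_val)
    (fun x => Metric.mem_ball_self (hr x)) (fun x y => F x y) (by
      rintro x y z ⟨hzx, hzy⟩
      obtain ⟨ε, hε, hεs⟩ := Metric.isOpen_iff.1
        (Metric.isOpen_ball.inter Metric.isOpen_ball) (z : Fin n → ℂ) ⟨hzx, hzy⟩
      have hb : Subtype.val ⁻¹' Metric.ball (z : Fin n → ℂ) ε ∈ nhds z :=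
        continuous_subtype_val.continuousAt.preimage_mem_nhds (Metric.ball_mem_nhds _ hε)
      filter_upwards [hb] with w hw
      have hd : ∀ a ∈ Metric.ball (z : Fin n → ℂ) ε,
          HasFDerivAt (fun p => F x p - F y p) 0 a := fun a ha => by
        have hsub := (hF x a (hεs ha).1).sub (hF y a (hεs ha).2)
        rw [sub_self] at hsub
        exact hsub
      exact Metric.isOpen_ball.is_const_of_fderiv_eq_zero (𝕜 := ℂ)
        (convex_ball _ _).isPreconnected
        (fun a ha => (hd a ha).differentiableAt.differentiableWithinAt)
        (fun a ha => (hd a ha).fderiv) hw (Metric.mem_ball_self hε))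
  have hfd : ∀ x : U, HasFDerivAt (Function.extend Subtype.val f 0) (W x) x := by
    intro x
    have h1 := hf x x (Metric.mem_ball_self (hr x))
    have h2 : Function.extend Subtype.val f 0 =ᶠ[nhds (x : Fin n → ℂ)]
        fun p => F x p + (f x - F x x) := by
      rw [← map_nhds_subtype_coe_eq_nhds x.2 (U.isOpen.mem_nhds x.2)]
      refine Filter.eventually_map.2 ?_
      filter_upwards [h1] with w hw
      rw [extend_coe f w.2]
      linear_combination hw
    exact ((hF x x (Metric.mem_ball_self (hr x))).add_const _).congr_of_eventuallyEq h2
  have hfhol : IsHol U f := by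
    refine (contDiffOn_infty_iff_fderiv_of_isOpen U.isOpen).2
      ⟨fun x hx => (hfd ⟨x, hx⟩).differentiableAt.differentiableWithinAt, ?_⟩
    exact hW.congr fun x hx => (hfd ⟨x, hx⟩).fderiv
  refine ⟨⟨f, hfhol⟩, fun α => Subtype.ext (funext fun x => ?_)⟩
  rw [pd_val, (hfd x).fderiv]
  simp [W, Pi.single_apply]

end Hol

end PrincipalHierarchy

/-! ### Differential polynomials over a ring with commuting derivations -/

namespace JetAlgebra

open MvPolynomial

theorem derivation_sum_apply {ι R A B : Type*} [CommSemiring R] [CommSemiring A] [AddCommMonoid B]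
    [Algebra R A] [Module A B] [Module R B] (S : Finset ι) (D : ι → Derivation R A B) (a : A) :
    (∑ i ∈ S, D i) a = ∑ i ∈ S, D i a := by
  have := congrFun (map_sum (Derivation.coeFnAddMonoidHom (R := R) (A := A) (M := B)) D S) a
  rw [Finset.sum_apply] at this
  exact this

theorem sum_mul_pderiv_eq_mkDerivation {σ R : Type*} [CommSemiring R] (φ : σ → MvPolynomial σ R)
    (S : Finset σ) {f : MvPolynomial σ R} (hf : f.vars ⊆ S) :
    ∑ j ∈ S, φ j * pderiv j f = mkDerivation R φ f := by
  classical
  have : (∑ j ∈ S, φ j • pderiv j : Derivation R (MvPolynomial σ R) (MvPolynomial σ R)) f =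
      mkDerivation R φ f := by
    refine derivation_eq_of_forall_mem_vars fun i hi => ?_
    rw [mkDerivation_X, derivation_sum_apply, Finset.sum_eq_single_of_mem i (hf hi)]
    · simp
    · intro j _ hj
      simp [pderiv_X_of_ne (Ne.symm hj)]
  rw [← this, derivation_sum_apply]
  rfl

theorem derivation_ext {σ R A : Type*} [CommSemiring R] [CommSemiring A] [Algebra R A]
    {D₁ D₂ : Derivation R (MvPolynomial σ A) (MvPolynomial σ A)}
    (hC : ∀ f : A, D₁ (C f) = D₂ (C f)) (hX : ∀ j, D₁ (X j) = D₂ (X j)) : D₁ = D₂ := by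
  refine Derivation.ext fun f => ?_
  induction f using MvPolynomial.induction_on with
  | C a => exact hC a
  | add p q hp hq => rw [map_add, map_add, hp, hq]
  | mul_X p j hp => rw [D₁.leibniz, D₂.leibniz, hp, hX]

variable {ι K : Type*} [CommRing K] [Algebra ℂ K]

theorem coeff_sum_monomial_derivation {σ : Type*} (d : Derivation ℂ K K) (f : MvPolynomial σ K)
    (m : σ →₀ ℕ) :
    coeff m (∑ m ∈ f.support, monomial m (d (f.coeff m))) = d (f.coeff m) := by
  classical
  rw [coeff_sum]
  simp only [coeff_monomial]
  rw [Finset.sum_ite_eq' f.support m]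
  split_ifs with hm
  · rfl
  · rw [notMem_support_iff.1 hm, map_zero]

/-- The extension of a derivation of the coefficients to polynomials, killing the variables. -/
def coeffDer {σ : Type*} (d : Derivation ℂ K K) :
    Derivation ℂ (MvPolynomial σ K) (MvPolynomial σ K) :=
  Derivation.mk'
    { toFun := fun f => ∑ m ∈ f.support, monomial m (d (f.coeff m))
      map_add' := fun f g => by
        ext1 m
        rw [coeff_sum_monomial_derivation, coeff_add, coeff_add, coeff_sum_monomial_derivation,
          coeff_sum_monomial_derivation, map_add]
      map_smul' := fun k f => by
        ext1 m
        rw [coeff_sum_monomial_derivation, RingHom.id_apply, coeff_smul, coeff_smul,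
          coeff_sum_monomial_derivation, d.map_smul] }
    fun f g => by
      classical
      ext1 m
      simp only [LinearMap.coe_mk, AddHom.coe_mk, coeff_sum_monomial_derivation, smul_eq_mul]
      rw [mul_comm g, coeff_add, coeff_mul, coeff_mul, coeff_mul, map_sum,
        ← Finset.sum_add_distrib]
      refine Finset.sum_congr rfl fun x _ => ?_
      simp only [Derivation.leibniz, coeff_sum_monomial_derivation, smul_eq_mul]
      ring

theorem coeff_coeffDer {σ : Type*} (d : Derivation ℂ K K) (f : MvPolynomial σ K) (m : σ →₀ ℕ) :
    coeff m (coeffDer d f) = d (coeff m f) :=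
  coeff_sum_monomial_derivation d f m

theorem coeffDer_monomial {σ : Type*} (d : Derivation ℂ K K) (m : σ →₀ ℕ) (a : K) :
    coeffDer d (monomial m a) = monomial m (d a) := by
  classical
  ext1 m'
  rw [coeff_coeffDer, coeff_monomial, coeff_monomial]
  split_ifs
  · rfl
  · rw [map_zero]

@[simp] theorem coeffDer_C {σ : Type*} (d : Derivation ℂ K K) (a : K) :
    coeffDer d (C a : MvPolynomial σ K) = C (d a) :=
  coeffDer_monomial d 0 a

@[simp] theorem coeffDer_X {σ : Type*} (d : Derivation ℂ K K) (j : σ) :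
    coeffDer d (X j : MvPolynomial σ K) = 0 := by
  rw [X, coeffDer_monomial, Derivation.map_one_eq_zero, map_zero]

section Jets

variable (D : ι → Derivation ℂ K K)

/-- The derivation `∂/∂v^{α,s}`. -/
def jetDer (α : ι) : ℕ → Derivation ℂ (MvPolynomial (ι × ℕ) K) (MvPolynomial (ι × ℕ) K)
  | 0 => coeffDer (D α)
  | s + 1 => (pderiv (α, s)).restrictScalars ℂ

theorem jetDer_succ (α : ι) (s : ℕ) (f : MvPolynomial (ι × ℕ) K) :
    jetDer D α (s + 1) f = pderiv (α, s) f := rfl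

theorem jetDer_zero (α : ι) : jetDer D α 0 = coeffDer (D α) := rfl

@[simp] theorem jetDer_zero_C (α : ι) (a : K) : jetDer D α 0 (C a) = C (D α a) :=
  coeffDer_C _ _

@[simp] theorem jetDer_succ_C (α : ι) (s : ℕ) (a : K) : jetDer D α (s + 1) (C a) = 0 :=
  pderiv_C

@[simp] theorem jetDer_zero_X (α : ι) (j : ι × ℕ) : jetDer D α 0 (X j) = 0 :=
  coeffDer_X _ _

theorem jetDer_succ_X [DecidableEq ι] (α : ι) (s : ℕ) (j : ι × ℕ) :
    jetDer D α (s + 1) (X j) = if j = (α, s) then 1 else 0 := by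
  rw [jetDer_succ, pderiv_X, Pi.single_apply]

/-- The largest `s` such that `v^{α,s}` occurs in `f` for some `α`, or `0` if there is none. -/
def order (f : MvPolynomial (ι × ℕ) K) : ℕ :=
  f.vars.sup fun j => j.2 + 1

theorem order_C {ι K : Type*} [CommRing K] (a : K) : order (C a : MvPolynomial (ι × ℕ) K) = 0 := by
  simp [order]

theorem jetDer_eq_zero_of_lt (α : ι) {s : ℕ} {f : MvPolynomial (ι × ℕ) K} (hs : order f < s) :
    jetDer D α s f = 0 := by
  cases s with
  | zero => simp at hs
  | succ s =>
    refine pderiv_eq_zero_of_notMem_vars fun hmem => ?_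
    have : s + 1 ≤ order f := Finset.le_sup (f := fun j : ι × ℕ => j.2 + 1) hmem
    omega

variable [Fintype ι]

/-- The total derivative. -/
def total : Derivation ℂ (MvPolynomial (ι × ℕ) K) (MvPolynomial (ι × ℕ) K) :=
  ∑ α, (X (α, 0) : MvPolynomial (ι × ℕ) K) • coeffDer (D α)
    + (mkDerivation K fun j : ι × ℕ =>
        (X (j.1, j.2 + 1) : MvPolynomial (ι × ℕ) K)).restrictScalars ℂ

theorem total_apply (f : MvPolynomial (ι × ℕ) K) {S : Finset (ι × ℕ)} (hS : f.vars ⊆ S) :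
    total D f = ∑ α, X (α, 0) * jetDer D α 0 f
      + ∑ j ∈ S, X (j.1, j.2 + 1) * jetDer D j.1 (j.2 + 1) f := by
  rw [total, Derivation.add_apply, derivation_sum_apply]
  congr 1
  exact (sum_mul_pderiv_eq_mkDerivation (fun j : ι × ℕ => X (j.1, j.2 + 1)) S hS).symm

theorem total_C (a : K) : total D (C a) = ∑ α, X (α, 0) * C (D α a) := by
  rw [total_apply D (C a) (S := ∅) (by simp)]
  simp

@[simp] theorem total_X (j : ι × ℕ) : total D (X j) = X (j.1, j.2 + 1) := by
  rw [total, Derivation.add_apply, derivation_sum_apply]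
  simp only [Derivation.smul_apply, coeffDer_X, smul_zero, Finset.sum_const_zero, zero_add]
  exact mkDerivation_X _ _ _

theorem total_eq_sum_range (f : MvPolynomial (ι × ℕ) K) {N : ℕ} (hN : order f ≤ N) :
    total D f = ∑ α, ∑ s ∈ Finset.range (N + 1), X (α, s) * jetDer D α s f := by
  classical
  rw [total_apply D f (S := Finset.univ ×ˢ Finset.range N) fun j hj => by
    have : j.2 + 1 ≤ order f := Finset.le_sup (f := fun j : ι × ℕ => j.2 + 1) hj
    simp only [Finset.mem_product, Finset.mem_univ, Finset.mem_range, true_and]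
    omega]
  rw [Finset.sum_product, ← Finset.sum_add_distrib]
  refine Finset.sum_congr rfl fun α _ => ?_
  rw [Finset.sum_range_succ', add_comm]

theorem jetDer_zero_total (hD : ∀ α β a, D α (D β a) = D β (D α a)) (α : ι)
    (f : MvPolynomial (ι × ℕ) K) :
    jetDer D α 0 (total D f) = total D (jetDer D α 0 f) := by
  have : ⁅jetDer D α 0, total D⁆ = 0 := by
    refine derivation_ext (fun a => ?_) fun j => ?_
    · simp only [Derivation.commutator_apply, total_C, map_sum, Derivation.leibniz,
        jetDer_zero_C, jetDer_zero_X, mul_zero, add_zero, Derivation.zero_apply, smul_eq_mul]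
      simp only [hD α, sub_self]
    · simp [Derivation.commutator_apply]
  have h := DFunLike.congr_fun this f
  simpa [Derivation.commutator_apply, sub_eq_zero] using h

/-- The shift comes from the factors v^{α,s+1} in ∂_x. Both sides are derivations after forming the
commutator, so functions and jet variables suffice. -/
theorem jetDer_succ_total (α : ι) (s : ℕ) (f : MvPolynomial (ι × ℕ) K) :
    jetDer D α (s + 1) (total D f) = total D (jetDer D α (s + 1) f) + jetDer D α s f := by
  classical
  have : ⁅jetDer D α (s + 1), total D⁆ = jetDer D α s := by
    refine derivation_ext (fun a => ?_) fun j => ?_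
    · rw [Derivation.commutator_apply, total_C, map_sum]
      simp only [Derivation.leibniz, jetDer_succ_C, map_zero, sub_zero,
        jetDer_succ_X, Prod.mk.injEq, smul_eq_mul]
      cases s with
      | zero => simp
      | succ s => simp
    · have h0 : total D (if j = (α, s) then 1 else 0) = 0 := by split_ifs <;> simp
      rw [Derivation.commutator_apply, total_X, jetDer_succ_X, jetDer_succ_X, h0, sub_zero]
      cases s with
      | zero => simp
      | succ s => simp [jetDer_succ_X, Prod.ext_iff]
  have h := DFunLike.congr_fun this f
  rw [← h, Derivation.commutator_apply]
  abel

/-! ### The variational derivative -/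

/-- The variational derivative. -/
def varDer (α : ι) (f : MvPolynomial (ι × ℕ) K) : MvPolynomial (ι × ℕ) K :=
  ∑ s ∈ Finset.range (order f + 1), (-1) ^ s * (total D)^[s] (jetDer D α s f)

theorem iterate_total_zero (s : ℕ) : (total D)^[s] 0 = 0 :=
  Function.iterate_fixed (map_zero _) s

theorem iterate_total_add (s : ℕ) (f g : MvPolynomial (ι × ℕ) K) :
    (total D)^[s] (f + g) = (total D)^[s] f + (total D)^[s] g :=
  iterate_map_add (total D) s f g

theorem varDer_eq_sum (α : ι) (f : MvPolynomial (ι × ℕ) K) {N : ℕ} (hN : order f ≤ N) :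
    varDer D α f = ∑ s ∈ Finset.range (N + 1), (-1) ^ s * (total D)^[s] (jetDer D α s f) := by
  rw [varDer]
  refine Finset.sum_subset (Finset.range_mono (by omega)) fun s _ hs => ?_
  rw [jetDer_eq_zero_of_lt D α (by simpa using hs), iterate_total_zero, mul_zero]

theorem varDer_add (α : ι) (f g : MvPolynomial (ι × ℕ) K) :
    varDer D α (f + g) = varDer D α f + varDer D α g := by
  set N := max (order (f + g)) (max (order f) (order g)) with hN
  rw [varDer_eq_sum D α (f + g) (N := N) (by omega), varDer_eq_sum D α f (N := N) (by omega),
    varDer_eq_sum D α g (N := N) (by omega), ← Finset.sum_add_distrib]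
  refine Finset.sum_congr rfl fun s _ => ?_
  rw [map_add, iterate_total_add, mul_add]

theorem varDer_C (α : ι) (a : K) : varDer D α (C a) = C (D α a) := by
  rw [varDer_eq_sum D α _ (N := 0) (order_C a).le]
  simp

theorem varDer_const (α : ι) (k : ℂ) : varDer D α (C (algebraMap ℂ K k)) = 0 := by
  rw [varDer_C, Derivation.map_algebraMap, map_zero]

/-- The commutation rule with ∂_x makes the alternating sum telescope: its partial sum up to M is
(-1)^M ∂_x^{M+1} ∂g/∂v^{α,M}, which vanishes for M beyond the order of g. -/
theorem varDer_total (hD : ∀ α β a, D α (D β a) = D β (D α a)) (α : ι)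
    (g : MvPolynomial (ι × ℕ) K) : varDer D α (total D g) = 0 := by
  set N := max (order (total D g)) (order g) + 1 with hN
  rw [varDer_eq_sum D α _ (N := N) (by omega)]
  have key : ∀ M, ∑ s ∈ Finset.range (M + 1),
      (-1) ^ s * (total D)^[s] (jetDer D α s (total D g)) =
      (-1) ^ M * (total D)^[M + 1] (jetDer D α M g) := by
    intro M
    induction M with
    | zero => simp [jetDer_zero_total D hD]
    | succ M ih =>
      rw [Finset.sum_range_succ, ih, jetDer_succ_total, iterate_total_add,
        ← Function.iterate_succ_apply]
      ring
  rw [key, jetDer_eq_zero_of_lt D α (by omega), iterate_total_zero, mul_zero]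

/-! ### The kernel of the total derivative -/

/-- A nonzero exponent is invertible in K because K is a ℂ-algebra. -/
theorem eq_C_of_pderiv_eq_zero {σ : Type*} {f : MvPolynomial σ K} (hf : ∀ j, pderiv j f = 0) :
    f = C (coeff 0 f) := by
  classical
  ext1 m
  rw [coeff_C]
  split_ifs with hm
  · rw [hm]
  · obtain ⟨j, hj⟩ : ∃ j, m j ≠ 0 := by
      by_contra! h
      exact hm (Finsupp.ext fun j => (h j).symm)
    have h1 := congrArg (coeff (m - Finsupp.single j 1)) (hf j)
    have hm' : m - Finsupp.single j 1 + Finsupp.single j 1 = m :=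
      tsub_add_cancel_of_le (Finsupp.single_le_iff.2 (Nat.one_le_iff_ne_zero.2 hj))
    rw [coeff_pderiv, coeff_zero, hm'] at h1
    have hu : IsUnit ((((m - Finsupp.single j 1 : σ →₀ ℕ) j : ℕ) : K) + 1) := by
      have := (IsUnit.mk0 ((((m - Finsupp.single j 1 : σ →₀ ℕ) j : ℕ) : ℂ) + 1)
        (Nat.cast_add_one_ne_zero _)).map (algebraMap ℂ K)
      simpa using this
    exact hu.mul_left_eq_zero.1 h1

/-- Descending induction on s: once ∂f/∂v^{α,s+1} = 0, commuting ∂/∂v^{α,s+1} with ∂_x leaves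
exactly ∂f/∂v^{α,s}. -/
theorem jetDer_eq_zero_of_total_eq_zero {f : MvPolynomial (ι × ℕ) K} (hf : total D f = 0)
    (α : ι) (s : ℕ) : jetDer D α s f = 0 := by
  have key : ∀ k s, order f < s + k → jetDer D α s f = 0 := by
    intro k
    induction k with
    | zero => exact fun s hs => jetDer_eq_zero_of_lt D α hs
    | succ k ih =>
      intro s hs
      have h1 := jetDer_succ_total D α s f
      rw [hf, ih (s + 1) (by omega), map_zero, map_zero, zero_add] at h1
      exact h1.symm
  exact key (order f + 1) s (by omega)

theorem exists_eq_const_of_total_eq_zero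
    (hconst : ∀ a, (∀ α, D α a = 0) → ∃ k, a = algebraMap ℂ K k)
    {f : MvPolynomial (ι × ℕ) K} (hf : total D f = 0) : ∃ k, f = C (algebraMap ℂ K k) := by
  have h1 := eq_C_of_pderiv_eq_zero (f := f) fun j =>
    (jetDer_succ D j.1 j.2 f).symm.trans (jetDer_eq_zero_of_total_eq_zero D hf j.1 (j.2 + 1))
  obtain ⟨k, hk⟩ := hconst (coeff 0 f) fun α => by
    have h2 := congrArg (coeff 0) (jetDer_eq_zero_of_total_eq_zero D hf α 0)
    rw [jetDer_zero, coeff_coeffDer, coeff_zero] at h2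
    exact h2
  exact ⟨k, by rw [← hk]; exact h1⟩

end Jets

end JetAlgebra

namespace JetAlgebra

open MvPolynomial

variable {ι K : Type*} [CommRing K] [Algebra ℂ K]

/-! ### The weight grading -/

/-- The differential degree of a jet monomial: `v^{α,s}` has degree `s`. -/
abbrev wt : (ι × ℕ →₀ ℕ) →+ ℕ := Finsupp.weight fun j : ι × ℕ => j.2 + 1

theorem wt_single (j : ι × ℕ) : wt (Finsupp.single j 1) = j.2 + 1 := by
  simp [Finsupp.weight_single]

theorem eq_zero_of_wt_eq_zero {m : ι × ℕ →₀ ℕ} (h : wt m = 0) : m = 0 := by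
  ext j
  by_contra hj
  have := Finsupp.le_weight (fun j : ι × ℕ => j.2 + 1) (s := j) (Nat.succ_ne_zero _) m
  simp only [Finsupp.coe_zero, Pi.zero_apply] at hj
  change m j ≤ wt m at this
  omega

theorem exists_eq_single_of_wt_eq_one {m : ι × ℕ →₀ ℕ} (h : wt m = 1) :
    ∃ α, m = Finsupp.single (α, 0) 1 := by
  obtain ⟨j, hj⟩ : ∃ j, m j ≠ 0 := by
    by_contra! h'
    rw [show m = 0 from Finsupp.ext h', map_zero] at h
    exact zero_ne_one h
  have hm : m - Finsupp.single j 1 + Finsupp.single j 1 = m :=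
    tsub_add_cancel_of_le (Finsupp.single_le_iff.2 (Nat.one_le_iff_ne_zero.2 hj))
  have h2 : wt (m - Finsupp.single j 1) + (j.2 + 1) = 1 := by
    rw [← wt_single, ← map_add, hm, h]
  have h3 := eq_zero_of_wt_eq_zero (m := m - Finsupp.single j 1) (by omega)
  refine ⟨j.1, ?_⟩
  rw [← hm, h3, zero_add, show j = (j.1, 0) from Prod.ext rfl (by simp; omega)]

/-- Multiplication of the component of differential degree `d` by `φ d`. -/
def scale (φ : ℕ → ℂ) : MvPolynomial (ι × ℕ) K →ₗ[K] MvPolynomial (ι × ℕ) K :=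
  (basisMonomials (ι × ℕ) K).constr K fun m => monomial m (algebraMap ℂ K (φ (wt m)))

theorem scale_monomial (φ : ℕ → ℂ) (m : ι × ℕ →₀ ℕ) (a : K) :
    scale φ (monomial m a) = φ (wt m) • monomial m a := by
  have h1 : (monomial m a : MvPolynomial (ι × ℕ) K) = a • basisMonomials (ι × ℕ) K m := by
    simp [smul_monomial]
  rw [h1, map_smul, scale, Module.Basis.constr_basis, ← h1, smul_monomial, smul_monomial,
    smul_eq_mul, mul_comm, ← Algebra.smul_def]

theorem scale_comp (φ ψ : ℕ → ℂ) (f : MvPolynomial (ι × ℕ) K) :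
    scale φ (scale ψ f) = scale (fun d => φ d * ψ d) f := by
  induction f using MvPolynomial.induction_on' with
  | monomial m a =>
    rw [scale_monomial, scale_monomial, LinearMap.map_smul_of_tower, scale_monomial, smul_smul,
      mul_comm]
  | add p q hp hq => simp only [map_add, hp, hq]

theorem scale_one (f : MvPolynomial (ι × ℕ) K) : scale (fun _ => 1) f = f := by
  induction f using MvPolynomial.induction_on' with
  | monomial m a => rw [scale_monomial, one_smul]
  | add p q hp hq => simp only [map_add, hp, hq]

theorem scale_sub (φ ψ : ℕ → ℂ) (f : MvPolynomial (ι × ℕ) K) :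
    scale (fun d => φ d - ψ d) f = scale φ f - scale ψ f := by
  induction f using MvPolynomial.induction_on' with
  | monomial m a => simp only [scale_monomial, sub_smul]
  | add p q hp hq => simp only [map_add, hp, hq]; abel

theorem scale_of_isWeightedHomogeneous (φ : ℕ → ℂ) {f : MvPolynomial (ι × ℕ) K} {d : ℕ}
    (hf : IsWeightedHomogeneous (fun j : ι × ℕ => j.2 + 1) f d) : scale φ f = φ d • f := by
  rw [f.as_sum, map_sum, Finset.smul_sum]
  refine Finset.sum_congr rfl fun m hm => ?_
  rw [scale_monomial, show wt m = d from hf (mem_support_iff.1 hm)]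

/-- The weighted Euler identity. -/
theorem mkDerivation_weight_X (f : MvPolynomial (ι × ℕ) K) :
    mkDerivation K (fun j : ι × ℕ => (j.2 + 1) • (X j : MvPolynomial (ι × ℕ) K)) f =
      scale (fun d => (d : ℂ)) f := by
  induction f using MvPolynomial.induction_on' with
  | monomial m a =>
    rw [mkDerivation_monomial, scale_monomial, Nat.cast_smul_eq_nsmul, Finsupp.weight_apply,
      Finsupp.sum, Finsupp.sum, Finset.sum_smul, Finset.smul_sum]
    refine Finset.sum_congr rfl fun j hj => ?_
    have hm : m - Finsupp.single j 1 + Finsupp.single j 1 = m :=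
      tsub_add_cancel_of_le (Finsupp.single_le_iff.2
        (Nat.one_le_iff_ne_zero.2 (Finsupp.mem_support_iff.1 hj)))
    rw [smul_eq_mul, mul_smul_comm, X, monomial_mul, hm, mul_one, smul_comm, smul_monomial,
      smul_eq_mul, smul_eq_mul, mul_comm (m j), mul_smul]
    congr 1
    rw [smul_monomial, nsmul_eq_mul, mul_comm]
  | add p q hp hq => simp only [map_add, hp, hq]

variable [Fintype ι] (D : ι → Derivation ℂ K K)

theorem isWeightedHomogeneous_total_monomial (m : ι × ℕ →₀ ℕ) (a : K) :
    IsWeightedHomogeneous (fun j : ι × ℕ => j.2 + 1) (total D (monomial m a)) (wt m + 1) := by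
  rw [total_apply D _ subset_rfl, ← mem_weightedHomogeneousSubmodule]
  refine Submodule.add_mem _ (Submodule.sum_mem _ fun α _ => ?_) (Submodule.sum_mem _ fun j _ => ?_)
  · rw [jetDer_zero, coeffDer_monomial, mem_weightedHomogeneousSubmodule, X, monomial_mul]
    refine isWeightedHomogeneous_monomial _ _ _ ?_
    change wt (Finsupp.single (α, 0) 1 + m) = wt m + 1
    rw [map_add, wt_single, zero_add, add_comm]
  · rw [jetDer_succ, pderiv_monomial, mem_weightedHomogeneousSubmodule, X, monomial_mul]
    by_cases hj : m j = 0
    · rw [hj, Nat.cast_zero, mul_zero, mul_zero, map_zero]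
      exact isWeightedHomogeneous_zero _ _ _
    · have hm : m - Finsupp.single j 1 + Finsupp.single j 1 = m :=
        tsub_add_cancel_of_le (Finsupp.single_le_iff.2 (Nat.one_le_iff_ne_zero.2 hj))
      refine isWeightedHomogeneous_monomial _ _ _ ?_
      have h2 : wt m = wt (m - Finsupp.single j 1) + (j.2 + 1) := by
        rw [← wt_single, ← map_add, hm]
      change wt (Finsupp.single (j.1, j.2 + 1) 1 + (m - Finsupp.single j 1)) = wt m + 1
      rw [map_add, wt_single, h2]
      ring

theorem scale_total (φ : ℕ → ℂ) (f : MvPolynomial (ι × ℕ) K) :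
    scale φ (total D f) = total D (scale (fun d => φ (d + 1)) f) := by
  induction f using MvPolynomial.induction_on' with
  | monomial m a =>
    rw [scale_of_isWeightedHomogeneous φ (isWeightedHomogeneous_total_monomial D m a),
      scale_monomial, Derivation.map_smul]
  | add p q hp hq => simp only [map_add, hp, hq]

/-! ### The kernel of the variational derivative -/

/-- The boundary term in the integration by parts of `u_s g`, where `u_s` is the `s`-th
derivative of `u_0`. -/
def boundary (u : ℕ → MvPolynomial (ι × ℕ) K) :
    ℕ → MvPolynomial (ι × ℕ) K → MvPolynomial (ι × ℕ) K
  | 0, _ => 0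
  | s + 1, g => u s * g - boundary u s (total D g)

theorem boundary_zero (s : ℕ) (g : MvPolynomial (ι × ℕ) K) :
    boundary D (fun _ => 0) s g = 0 := by
  induction s generalizing g with
  | zero => rfl
  | succ s ih => rw [boundary, ih, zero_mul, sub_zero]

/-- Repeated integration by parts. The defect w allows both the jets themselves (w = 0) and the
weighted jets s v^{α,s}, whose defect is the sequence of jets. -/
theorem total_boundary {u w : ℕ → MvPolynomial (ι × ℕ) K}
    (hu : ∀ m, total D (u m) = u (m + 1) - w m) (s : ℕ) (g : MvPolynomial (ι × ℕ) K) :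
    total D (boundary D u s g) =
      u s * g - (-1) ^ s * u 0 * (total D)^[s] g - boundary D w s g := by
  induction s generalizing g with
  | zero => simp [boundary]
  | succ s ih =>
    rw [boundary, map_sub, ih, Derivation.leibniz, hu, boundary, Function.iterate_succ_apply]
    simp only [smul_eq_mul]
    ring

/-- The sequence `s v^{α,s}`. -/
def weightedJet (α : ι) : ℕ → MvPolynomial (ι × ℕ) K
  | 0 => 0
  | s + 1 => (s + 1) • X (α, s)

theorem total_weightedJet (α : ι) (s : ℕ) :
    total D (weightedJet α s) = weightedJet α (s + 1) - X (α, s) := by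
  cases s with
  | zero => simp [weightedJet]
  | succ s =>
    rw [weightedJet, weightedJet, map_nsmul, total_X, succ_nsmul _ (s + 1)]
    abel

theorem sum_weightedJet_mul (g : MvPolynomial (ι × ℕ) K) :
    ∑ α, ∑ s ∈ Finset.range (order g + 1), weightedJet α s * jetDer D α s g =
      scale (fun d => (d : ℂ)) g := by
  classical
  rw [← mkDerivation_weight_X, ← sum_mul_pderiv_eq_mkDerivation _
    (Finset.univ ×ˢ Finset.range (order g)) fun j hj => by
      have : j.2 + 1 ≤ order g := Finset.le_sup (f := fun j : ι × ℕ => j.2 + 1) hj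
      simp only [Finset.mem_product, Finset.mem_univ, Finset.mem_range, true_and]
      omega]
  rw [Finset.sum_product]
  refine Finset.sum_congr rfl fun α _ => ?_
  rw [Finset.sum_range_succ', weightedJet, zero_mul, add_zero]
  rfl

theorem scale_ite_eq_one (g : MvPolynomial (ι × ℕ) K) :
    scale (fun d => if d = 1 then 1 else 0) g =
      ∑ α, X (α, 0) * C (coeff (Finsupp.single (α, 0) 1) g) := by
  classical
  induction g using MvPolynomial.induction_on' with
  | monomial m a =>
    rw [scale_monomial]
    simp only [coeff_monomial]
    split_ifs with h
    · obtain ⟨α, rfl⟩ := exists_eq_single_of_wt_eq_one h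
      rw [Finset.sum_eq_single α]
      · rw [if_pos rfl, one_smul, mul_comm, C_mul_X_eq_monomial]
      · intro β _ hβ
        rw [if_neg, map_zero, mul_zero]
        intro h'
        have := Finsupp.single_left_injective one_ne_zero h'
        exact hβ (Prod.ext_iff.1 this).1.symm
      · simp
    · rw [zero_smul, Finset.sum_eq_zero]
      intro α _
      rw [if_neg, map_zero, mul_zero]
      rintro rfl
      exact h (wt_single _)
  | add p q hp hq => simp only [map_add, hp, hq, coeff_add, mul_add, Finset.sum_add_distrib]

/-- For a density given by a one-form, the variational derivative is the exterior derivative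
contracted with v_x. -/
theorem varDer_sum_X_mul_C (a : ι → K) (β : ι) :
    varDer D β (∑ α, X (α, 0) * C (a α)) = ∑ α, X (α, 0) * C (D β (a α) - D α (a β)) := by
  classical
  set f : MvPolynomial (ι × ℕ) K := ∑ α, X (α, 0) * C (a α) with hf
  have h0 : jetDer D β 0 f = ∑ α, X (α, 0) * C (D β (a α)) := by
    simp [hf, Derivation.leibniz]
  have h1 : jetDer D β 1 f = C (a β) := by
    simp only [hf, map_sum, Derivation.leibniz, jetDer_succ_C, jetDer_succ_X]
    simp
  have h2 : ∀ s, jetDer D β (s + 2) f = 0 := by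
    intro s
    simp only [hf, map_sum, Derivation.leibniz, jetDer_succ_C, jetDer_succ_X]
    simp
  rw [varDer_eq_sum D β f (Nat.le_succ _), Finset.sum_range_succ', Finset.sum_range_succ',
    Finset.sum_eq_zero fun s _ => by rw [h2, iterate_total_zero, mul_zero], h0]
  simp only [zero_add, h1, pow_one, Function.iterate_one, pow_zero, Function.iterate_zero,
    id_eq, total_C, one_mul, neg_mul, map_sub, mul_sub, Finset.sum_sub_distrib]
  abel

theorem eq_zero_of_sum_X_mul_C_eq_zero {ι K : Type*} [Fintype ι] [CommRing K] {a : ι → K}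
    (h : ∑ α, (X (α, 0) : MvPolynomial (ι × ℕ) K) * C (a α) = 0) (β : ι) : a β = 0 := by
  classical
  have h1 := congrArg (coeff (Finsupp.single (β, 0) 1)) h
  rw [coeff_sum, coeff_zero] at h1
  simp only [mul_comm (X _), coeff_C_mul, coeff_X, Finsupp.single_left_inj one_ne_zero,
    Prod.mk.injEq, and_true] at h1
  simpa using h1

/-- A differential polynomial with zero variational derivatives is a total derivative, up to a
constant. -/
theorem exists_eq_total_add_const_of_varDer_eq_zero
    (hD : ∀ α β a, D α (D β a) = D β (D α a))
    (hconst : ∀ a, (∀ α, D α a = 0) → ∃ k, a = algebraMap ℂ K k)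
    (hclosed : ∀ κ : ι → K, (∀ α β, D α (κ β) = D β (κ α)) → ∃ a, ∀ α, D α a = κ α)
    {g : MvPolynomial (ι × ℕ) K} (hg : ∀ α, varDer D α g = 0) :
    ∃ B k, g = total D B + C (algebraMap ℂ K k) := by
  classical
  set N := order g with hN
  -- Integration by parts turns ∑ v^{α,s+1} ∂g/∂v^{α,s} = ∂_x g into ∂_x B₀ plus v^α_x times the
  -- variational derivatives, which vanish. So B₀ is g up to a constant.
  obtain ⟨B₀, hB₀⟩ : ∃ B, B = ∑ α, ∑ s ∈ Finset.range (N + 1),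
    boundary D (fun m => X (α, m)) s (jetDer D α s g) := ⟨_, rfl⟩
  -- The same with s v^{α,s} in place of v^{α,s+1}. The sum is now the differential degree operator
  -- applied to g, the term with the variational derivative is absent since the sequence starts at
  -- 0, and the defect contributes B₀. Hence (deg - 1) g is ∂_x B₁ plus a constant.
  obtain ⟨B₁, hB₁⟩ : ∃ B, B = ∑ α, ∑ s ∈ Finset.range (N + 1),
    boundary D (weightedJet α) s (jetDer D α s g) := ⟨_, rfl⟩
  have h0 : total D B₀ = total D g := by
    rw [hB₀, total_eq_sum_range D g (N := N) le_rfl, map_sum]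
    have hE : ∀ α, X (α, 0) * varDer D α g = 0 := fun α => by rw [hg, mul_zero]
    refine Finset.sum_congr rfl fun α _ => ?_
    have hEα := hE α
    rw [varDer_eq_sum D α g (N := N) le_rfl, Finset.mul_sum] at hEα
    rw [map_sum, ← sub_eq_zero, ← Finset.sum_sub_distrib, ← neg_eq_zero,
      ← Finset.sum_neg_distrib, ← hEα]
    refine Finset.sum_congr rfl fun s _ => ?_
    rw [total_boundary D (w := fun _ => 0) (by simp), boundary_zero]
    ring
  obtain ⟨k, hk⟩ := exists_eq_const_of_total_eq_zero D hconst
    (f := B₀ - g) (by rw [map_sub, h0, sub_self])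
  have h1 : total D B₁ = scale (fun d => (d : ℂ)) g - B₀ := by
    rw [hB₁, hB₀, ← sum_weightedJet_mul D g, map_sum, ← Finset.sum_sub_distrib]
    refine Finset.sum_congr rfl fun α _ => ?_
    rw [map_sum, ← Finset.sum_sub_distrib]
    refine Finset.sum_congr rfl fun s _ => ?_
    rw [total_boundary D (total_weightedJet D α)]
    simp [weightedJet]
  have h2 : scale (fun d => (d : ℂ) - 1) g = total D B₁ + C (algebraMap ℂ K k) := by
    rw [scale_sub, scale_one, h1, ← hk]
    abel
  -- Inverts deg - 1 on all degrees except 1, where the convention 0⁻¹ = 0 makes the product vanish.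
  -- Only the degree-one part ∑ a_α v^α_x is left; it is closed by the variational equations, hence
  -- exact.
  obtain ⟨φ, hφ⟩ : ∃ φ : ℕ → ℂ, ∀ d, φ d * ((d : ℂ) - 1) = 1 - if d = 1 then 1 else 0 := by
    refine ⟨fun d => ((d : ℂ) - 1)⁻¹, fun d => ?_⟩
    split_ifs with hd
    · simp [hd]
    · rw [inv_mul_cancel₀, sub_zero]
      rw [sub_ne_zero]
      exact_mod_cast hd
  have h3 := congrArg (scale φ) h2
  rw [scale_comp, map_add, scale_total, C_apply, scale_monomial] at h3
  simp only [hφ] at h3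
  rw [scale_sub, scale_one, scale_ite_eq_one, map_zero] at h3
  set a : ι → K := fun α => coeff (Finsupp.single (α, 0) 1) g with ha
  set B₂ := scale (fun d => φ (d + 1)) B₁
  have h4 : φ 0 • (monomial 0 (algebraMap ℂ K k) : MvPolynomial (ι × ℕ) K) =
      C (algebraMap ℂ K (φ 0 * k)) := by
    rw [smul_monomial, C_apply, map_mul, Algebra.smul_def]
  rw [h4, sub_eq_iff_eq_add] at h3
  have h5 : ∀ β, varDer D β (∑ α, X (α, 0) * C (a α)) = 0 := by
    intro β
    have := hg β
    rw [h3, varDer_add, varDer_add, varDer_total D hD, varDer_const, zero_add, zero_add] at this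
    exact this
  obtain ⟨F, hF⟩ := hclosed a fun α β => by
    have := h5 α
    rw [varDer_sum_X_mul_C] at this
    exact sub_eq_zero.1 (eq_zero_of_sum_X_mul_C_eq_zero this β)
  refine ⟨B₂ + C F, φ 0 * k, ?_⟩
  rw [map_add, total_C]
  simp only [hF]
  rw [h3]
  abel

end JetAlgebra

namespace JetAlgebra

open MvPolynomial Matrix

/-! ### Multiplication by the first jet -/

section FirstJet

variable {ι K : Type*} [Fintype ι] [CommRing K] (c : ι → ι → ι → K)

/-- The matrix of multiplication by `∂/∂v^δ`, where `c ν γ δ` is the structure function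
`c^ν_{γδ}`. -/
def mulMatrix (δ : ι) : Matrix ι ι (MvPolynomial (ι × ℕ) K) :=
  Matrix.of fun ν γ => C (c ν γ δ)

/-- The matrix of multiplication by `v_x`. -/
def firstJetMatrix : Matrix ι ι (MvPolynomial (ι × ℕ) K) :=
  ∑ δ, (X (δ, 0) : MvPolynomial (ι × ℕ) K) • mulMatrix c δ

theorem firstJetMatrix_apply (ν γ : ι) :
    firstJetMatrix c ν γ = ∑ δ, X (δ, 0) * C (c ν γ δ) := by
  simp [firstJetMatrix, mulMatrix, Matrix.sum_apply]

theorem firstJetMatrix_mulVec (y : ι → MvPolynomial (ι × ℕ) K) (ν : ι) :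
    (firstJetMatrix c *ᵥ y) ν = ∑ δ, X (δ, 0) * ∑ γ, C (c ν γ δ) * y γ := by
  simp only [mulVec, dotProduct, firstJetMatrix_apply, Finset.sum_mul, Finset.mul_sum]
  rw [Finset.sum_comm]
  simp only [mul_assoc]

theorem mulMatrix_mulVec (y : ι → MvPolynomial (ι × ℕ) K) (δ ν : ι) :
    (mulMatrix c δ *ᵥ y) ν = ∑ γ, C (c ν γ δ) * y γ := rfl

variable {c}

theorem mulMatrix_mul_firstJetMatrix
    (hcomm : ∀ μ δ ν γ, ∑ ρ, c ν ρ μ * c ρ γ δ = ∑ ρ, c ν ρ δ * c ρ γ μ) (μ : ι) :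
    mulMatrix c μ * firstJetMatrix c = firstJetMatrix c * mulMatrix c μ := by
  rw [firstJetMatrix, Matrix.mul_sum, Matrix.sum_mul]
  refine Finset.sum_congr rfl fun δ _ => ?_
  rw [Matrix.mul_smul, Matrix.smul_mul]
  congr 1
  ext1 ν γ
  simp only [Matrix.mul_apply, mulMatrix, Matrix.of_apply, ← map_mul, ← map_sum, hcomm μ δ]

/-- Multiplication by `v_x` is injective on differential polynomials: its determinant is monic in
the first jet of the coordinate along the unit. -/
theorem eq_zero_of_firstJetMatrix_mulVec_eq_zero [DecidableEq ι] {o : ι}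
    (hunit : ∀ ν γ, c ν γ o = if ν = γ then 1 else 0) {y : ι → MvPolynomial (ι × ℕ) K}
    (hy : firstJetMatrix c *ᵥ y = 0) : y = 0 := by
  classical
  -- Downward induction on the exponent d of v^o_x. In the coefficient of m plus one more v^o_x, the
  -- term δ = o returns the coefficient at m, while every other δ involves coefficients of exponent
  -- at least d + 1.
  have key : ∀ k d, (∑ ν, degreeOf (o, 0) (y ν)) < d + k →
      ∀ ν m, d ≤ m (o, 0) → coeff m (y ν) = 0 := by
    intro k
    induction k with
    | zero =>
      intro d hd ν m hm
      by_contra hne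
      have h1 := monomial_le_degreeOf (o, 0) (mem_support_iff.2 hne)
      have h2 := Finset.single_le_sum (f := fun ν => degreeOf (o, 0) (y ν))
        (fun _ _ => Nat.zero_le _) (Finset.mem_univ ν)
      omega
    | succ k ih =>
      intro d hd ν m hm
      have h1 := congrArg (coeff (m + Finsupp.single (o, 0) 1)) (congrFun hy ν)
      rw [firstJetMatrix_mulVec, coeff_sum, Pi.zero_apply, coeff_zero,
        Finset.sum_eq_single o] at h1
      · rw [add_comm, coeff_X_mul] at h1
        simpa [hunit, coeff_sum] using h1
      · intro δ _ hδ
        rw [coeff_X_mul']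
        split_ifs
        · rw [coeff_sum, Finset.sum_eq_zero]
          intro γ _
          rw [coeff_C_mul, ih (d + 1) (by omega), mul_zero]
          have : ((δ, 0) : ι × ℕ) ≠ (o, 0) := fun h => hδ (Prod.ext_iff.1 h).1
          simpa [this] using hm
        · rfl
      · simp
  funext ν
  ext1 m
  exact key (∑ ν, degreeOf (o, 0) (y ν) + 1) 0 (by omega) ν m (Nat.zero_le _)

theorem eq_zero_of_firstJetMatrix_pow_mulVec_eq_zero [DecidableEq ι] {o : ι}
    (hunit : ∀ ν γ, c ν γ o = if ν = γ then 1 else 0) {y : ι → MvPolynomial (ι × ℕ) K}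
    (s : ℕ) (hy : firstJetMatrix c ^ s *ᵥ y = 0) : y = 0 := by
  induction s with
  | zero => simpa using hy
  | succ s ih =>
    rw [pow_succ', ← mulVec_mulVec] at hy
    exact ih (eq_zero_of_firstJetMatrix_mulVec_eq_zero hunit hy)

end FirstJet

/-! ### Pairings with deformed flat coordinates -/

section Pairing

variable {ι J K : Type*} [Fintype ι] [CommRing K] [Algebra ℂ K] (D : ι → Derivation ℂ K K)
  (c : ι → ι → ι → K) (ξ : J → ℕ → ι → K)

/-- The coefficient of `z^q` in the pairing of `∑ₖ S_k z^k` with `∑ₗ ξ_{a,l} z^l`. -/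
def pairing (S : ℕ → ι → MvPolynomial (ι × ℕ) K) (a : J) (q : ℕ) : MvPolynomial (ι × ℕ) K :=
  ∑ k ∈ Finset.range (q + 1), ∑ ν, S k ν * C (ξ a (q - k) ν)

/-- The system is triangular in k: once S_0, …, S_{k-1} vanish, the z^k-coefficient pairs S_k with
the nondegenerate constant covectors ξ_{a,0}. -/
theorem eq_zero_of_pairing_eq_zero {ι J K : Type*} [Fintype ι] [CommRing K] (ξ : J → ℕ → ι → K)
    (hξ : ∀ y : ι → MvPolynomial (ι × ℕ) K, (∀ a, ∑ ν, y ν * C (ξ a 0 ν) = 0) → y = 0)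
    {S : ℕ → ι → MvPolynomial (ι × ℕ) K} (hS : ∀ a q, pairing ξ S a q = 0) (k : ℕ) : S k = 0 := by
  induction k using Nat.strong_induction_on with
  | _ k ih =>
    refine hξ _ fun a => ?_
    have h := hS a k
    rw [pairing, Finset.sum_range_succ, Finset.sum_eq_zero, zero_add, Nat.sub_self] at h
    · exact h
    · intro l hl
      rw [ih l (Finset.mem_range.1 hl)]
      simp

theorem pairing_sum {ι J K T : Type*} [Fintype ι] [CommRing K] (ξ : J → ℕ → ι → K) (I : Finset T) (S : T → ℕ → ι → MvPolynomial (ι × ℕ) K) (a : J)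
    (q : ℕ) : pairing ξ (∑ i ∈ I, S i) a q = ∑ i ∈ I, pairing ξ (S i) a q := by
  simp only [pairing, Finset.sum_apply, Finset.sum_mul]
  rw [Finset.sum_comm (s := I)]
  exact Finset.sum_congr rfl fun k _ => Finset.sum_comm

/-- The negative of the operator on sequences that corresponds to the total derivative of the
pairing with deformed flat coordinates. -/
def negConn (S : ℕ → ι → MvPolynomial (ι × ℕ) K) : ℕ → ι → MvPolynomial (ι × ℕ) K
  | 0 => fun ν => -total D (S 0 ν)
  | k + 1 => fun ν => -total D (S (k + 1) ν) - (firstJetMatrix c *ᵥ S k) ν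

theorem negConn_zero : negConn D c 0 = 0 := by
  funext k ν
  cases k <;> simp [negConn]

variable {D c ξ}

/-- With ∂_μ ξ = z C_μᵀ ξ, differentiating ξ along x moves z C_{v_x} onto S, so -∂_x on pairings
becomes -(∂_x + z C_{v_x}) on sequences. -/
theorem pairing_negConn (hξ0 : ∀ a μ ν, D μ (ξ a 0 ν) = 0)
    (hξ : ∀ a q μ ν, D μ (ξ a (q + 1) ν) = ∑ ρ, c ρ ν μ * ξ a q ρ)
    (S : ℕ → ι → MvPolynomial (ι × ℕ) K) (a : J) (q : ℕ) :
    pairing ξ (negConn D c S) a q = -total D (pairing ξ S a q) := by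
  have hT0 : ∀ ν, total D (C (ξ a 0 ν)) = 0 := fun ν => by simp [total_C, hξ0]
  have hT : ∀ l (y : ι → MvPolynomial (ι × ℕ) K), ∑ ν, y ν * total D (C (ξ a (l + 1) ν)) =
      ∑ ν, (firstJetMatrix c *ᵥ y) ν * C (ξ a l ν) := by
    intro l y
    simp only [total_C, hξ, firstJetMatrix_mulVec, map_sum, map_mul, Finset.mul_sum,
      Finset.sum_mul]
    calc _ = ∑ ν, ∑ ρ, ∑ δ, y ν * (X (δ, 0) * (C (c ρ ν δ) * C (ξ a l ρ))) :=
          Finset.sum_congr rfl fun ν _ => Finset.sum_comm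
      _ = ∑ ρ, ∑ ν, ∑ δ, y ν * (X (δ, 0) * (C (c ρ ν δ) * C (ξ a l ρ))) := Finset.sum_comm
      _ = _ := by
        refine Finset.sum_congr rfl fun ρ _ => ?_
        rw [Finset.sum_comm]
        refine Finset.sum_congr rfl fun δ _ => Finset.sum_congr rfl fun ν _ => ?_
        ring
  have hL : total D (pairing ξ S a q) =
      (∑ k ∈ Finset.range (q + 1), ∑ ν, total D (S k ν) * C (ξ a (q - k) ν)) +
        ∑ k ∈ Finset.range (q + 1), ∑ ν, S k ν * total D (C (ξ a (q - k) ν)) := by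
    rw [pairing, map_sum, ← Finset.sum_add_distrib]
    refine Finset.sum_congr rfl fun k _ => ?_
    rw [map_sum, ← Finset.sum_add_distrib]
    refine Finset.sum_congr rfl fun ν _ => ?_
    rw [Derivation.leibniz, smul_eq_mul, smul_eq_mul]
    ring
  have hR : pairing ξ (negConn D c S) a q =
      -(∑ k ∈ Finset.range (q + 1), ∑ ν, total D (S k ν) * C (ξ a (q - k) ν)) -
        ∑ k ∈ Finset.range q, ∑ ν, (firstJetMatrix c *ᵥ S k) ν * C (ξ a (q - (k + 1)) ν) := by
    rw [pairing, Finset.sum_range_succ', Finset.sum_range_succ' _ q]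
    simp only [negConn, sub_mul, neg_mul, Finset.sum_sub_distrib, Finset.sum_neg_distrib]
    ring
  rw [hL, hR, Finset.sum_range_succ (fun k => ∑ ν, S k ν * total D (C (ξ a (q - k) ν)))]
  have h1 : ∑ ν, S q ν * total D (C (ξ a (q - q) ν)) = 0 := by simp [hT0]
  have h2 : ∑ k ∈ Finset.range q, ∑ ν, S k ν * total D (C (ξ a (q - k) ν)) =
      ∑ k ∈ Finset.range q, ∑ ν, (firstJetMatrix c *ᵥ S k) ν * C (ξ a (q - (k + 1)) ν) := by
    refine Finset.sum_congr rfl fun k hk => ?_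
    rw [← hT, show q - (k + 1) + 1 = q - k by have := Finset.mem_range.1 hk; omega]
  rw [h1, h2]
  ring

theorem pairing_negConn_iterate (hξ0 : ∀ a μ ν, D μ (ξ a 0 ν) = 0)
    (hξ : ∀ a q μ ν, D μ (ξ a (q + 1) ν) = ∑ ρ, c ρ ν μ * ξ a q ρ)
    (S : ℕ → ι → MvPolynomial (ι × ℕ) K) (a : J) (q s : ℕ) :
    pairing ξ ((negConn D c)^[s] S) a q = (-1) ^ s * (total D)^[s] (pairing ξ S a q) := by
  induction s with
  | zero => simp
  | succ s ih =>
    rw [Function.iterate_succ_apply', pairing_negConn hξ0 hξ, ih, Function.iterate_succ_apply',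
      Derivation.leibniz]
    have : total D ((-1) ^ s) = 0 := by
      rw [show ((-1) ^ s : MvPolynomial (ι × ℕ) K) = ((-1 : ℤ) ^ s : ℤ) by push_cast; rfl]
      exact Derivation.map_intCast _ _
    rw [this, smul_zero, add_zero, smul_eq_mul]
    ring

/-- Each application raises the degree in z by at most one, and the top coefficient only sees
-C_{v_x}. -/
theorem negConn_iterate_of_lt [DecidableEq ι] {S : ℕ → ι → MvPolynomial (ι × ℕ) K} (hS : ∀ k, S (k + 1) = 0)
    (s : ℕ) : (∀ k, s < k → (negConn D c)^[s] S k = 0) ∧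
      (negConn D c)^[s] S s = (-1 : MvPolynomial (ι × ℕ) K) ^ s • (firstJetMatrix c ^ s *ᵥ S 0) := by
  induction s with
  | zero =>
    refine ⟨fun k hk => ?_, by simp⟩
    obtain ⟨k, rfl⟩ := Nat.exists_eq_succ_of_ne_zero hk.ne'
    exact hS k
  | succ s ih =>
    refine ⟨fun k hk => ?_, ?_⟩
    · obtain ⟨k, rfl⟩ := Nat.exists_eq_succ_of_ne_zero (Nat.ne_zero_of_lt hk)
      funext ν
      rw [Function.iterate_succ_apply', negConn, ih.1 (k + 1) (by omega), ih.1 k (by omega)]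
      simp
    · funext ν
      rw [Function.iterate_succ_apply', negConn, ih.1 (s + 1) (by omega), ih.2, mulVec_smul,
        mulVec_mulVec, ← pow_succ']
      simp [pow_succ]

end Pairing

/-! ### Densities that annihilate all deformed flat coordinates -/

section Symmetry

variable {ι J K : Type*} [Fintype ι] [CommRing K] [Algebra ℂ K]
  {D : ι → Derivation ℂ K K} {c : ι → ι → ι → K} {ξ : J → ℕ → ι → K}

/-- The sequences whose pairings are the partial derivatives of `∑_ν Q^ν ξ_{a,q,ν}`. -/
def jetSeq (D : ι → Derivation ℂ K K) (c : ι → ι → ι → K) (μ : ι)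
    (Q : ι → MvPolynomial (ι × ℕ) K) : ℕ → ℕ → ι → MvPolynomial (ι × ℕ) K
  | s, 0 => fun ν => jetDer D μ s (Q ν)
  | 0, 1 => mulMatrix c μ *ᵥ Q
  | _, _ => 0

/-- Since ξ contains no jets, differentiating it contributes only for s = 0, and there it gives the
term z C_μ Q. -/
theorem jetDer_sum_mul_eq_pairing (hξ0 : ∀ a μ ν, D μ (ξ a 0 ν) = 0)
    (hξ : ∀ a q μ ν, D μ (ξ a (q + 1) ν) = ∑ ρ, c ρ ν μ * ξ a q ρ)
    (Q : ι → MvPolynomial (ι × ℕ) K) (μ : ι) (s : ℕ) (a : J) (q : ℕ) :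
    jetDer D μ s (∑ ν, Q ν * C (ξ a q ν)) = pairing ξ (jetSeq D c μ Q s) a q := by
  have hsum : jetDer D μ s (∑ ν, Q ν * C (ξ a q ν)) =
      ∑ ν, jetDer D μ s (Q ν) * C (ξ a q ν) + ∑ ν, Q ν * jetDer D μ s (C (ξ a q ν)) := by
    rw [map_sum, ← Finset.sum_add_distrib]
    refine Finset.sum_congr rfl fun ν _ => ?_
    rw [Derivation.leibniz, smul_eq_mul, smul_eq_mul]
    ring
  rw [hsum, pairing, Finset.sum_range_succ', add_comm, Nat.sub_zero]
  congr 1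
  cases s with
  | succ s =>
    rw [Finset.sum_eq_zero, Finset.sum_eq_zero]
    · intro k _
      simp [jetSeq]
    · simp
  | zero =>
    cases q with
    | zero => simp [hξ0]
    | succ q =>
      symm
      rw [Finset.sum_eq_single_of_mem 0 (by simp)]
      · rw [show jetSeq D c μ Q 0 (0 + 1) = mulMatrix c μ *ᵥ Q from rfl]
        simp only [mulMatrix_mulVec, jetDer_zero_C, hξ, map_sum, map_mul, Finset.mul_sum,
          Finset.sum_mul, Nat.add_sub_cancel, zero_add]
        rw [Finset.sum_comm]
        refine Finset.sum_congr rfl fun ρ _ => Finset.sum_congr rfl fun ν _ => ?_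
        ring
      · intro k _ hk
        obtain ⟨k, rfl⟩ := Nat.exists_eq_succ_of_ne_zero hk
        simp [jetSeq]

/-- If all densities `∑_ν Q^ν ξ_{a,q,ν}` have zero variational derivatives, then `Q` depends only
on the first jets and satisfies two first order equations. -/
theorem firstOrder_of_varDer_pairing_eq_zero [DecidableEq ι] {o : ι}
    (hunit : ∀ ν γ, c ν γ o = if ν = γ then 1 else 0)
    (hξ0 : ∀ a μ ν, D μ (ξ a 0 ν) = 0)
    (hξ : ∀ a q μ ν, D μ (ξ a (q + 1) ν) = ∑ ρ, c ρ ν μ * ξ a q ρ)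
    (hnd : ∀ y : ι → MvPolynomial (ι × ℕ) K, (∀ a, ∑ ν, y ν * C (ξ a 0 ν) = 0) → y = 0)
    {Q : ι → MvPolynomial (ι × ℕ) K} {μ : ι}
    (hQ : ∀ a q, varDer D μ (∑ ν, Q ν * C (ξ a q ν)) = 0) :
    (∀ s ν, jetDer D μ (s + 2) (Q ν) = 0) ∧
      (∀ ν, jetDer D μ 0 (Q ν) = total D (jetDer D μ 1 (Q ν))) ∧
      (mulMatrix c μ *ᵥ Q = firstJetMatrix c *ᵥ fun ν => jetDer D μ 1 (Q ν)) := by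
  set N := ∑ ν, order (Q ν) + 1 with hN
  have hNQ : ∀ s, N ≤ s → ∀ ν, jetDer D μ s (Q ν) = 0 := by
    intro s hs ν
    refine jetDer_eq_zero_of_lt D μ (lt_of_lt_of_le ?_ hs)
    have := Finset.single_le_sum (f := fun ν => order (Q ν))
      (fun _ _ => Nat.zero_le _) (Finset.mem_univ ν)
    omega
  have hseq : ∀ s k, jetSeq D c μ Q (s + 1) (k + 1) = 0 := fun s k => by
    cases k <;> rfl
  have hseq0 : ∀ s, jetSeq D c μ Q s 0 = fun ν => jetDer D μ s (Q ν) := fun s => by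
    cases s <;> rfl
  have hseqN : ∀ s, (∀ ν, jetDer D μ (s + 1) (Q ν) = 0) → jetSeq D c μ Q (s + 1) = 0 := by
    intro s hs
    funext k ν
    cases k with
    | zero => exact hs ν
    | succ k => rw [hseq]; rfl
  -- The variational derivative in the direction μ, moved entirely onto the side of Q.
  set Z : ℕ → ι → MvPolynomial (ι × ℕ) K :=
    ∑ s ∈ Finset.range (N + 1), (negConn D c)^[s] (jetSeq D c μ Q s) with hZ
  have hZ0 : ∀ k, Z k = 0 := by
    refine eq_zero_of_pairing_eq_zero ξ hnd fun a q => ?_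
    obtain ⟨P, hP⟩ : ∃ P, P = ∑ ν, Q ν * C (ξ a q ν) := ⟨_, rfl⟩
    rw [hZ, pairing_sum]
    have hPN : ∀ s, N < s → jetDer D μ s P = 0 := by
      intro s hs
      obtain ⟨s, rfl⟩ := Nat.exists_eq_succ_of_ne_zero (Nat.ne_zero_of_lt hs)
      rw [hP, jetDer_sum_mul_eq_pairing (c := c) hξ0 hξ, hseqN s (hNQ _ hs.le)]
      simp [pairing]
    have h1 := hQ a q
    rw [← hP, varDer_eq_sum D μ P (le_max_left _ N)] at h1
    rw [← h1]
    rw [← Finset.sum_subset (Finset.range_mono (Nat.succ_le_succ (le_max_right (order P) N)))]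
    · refine Finset.sum_congr rfl fun s _ => ?_
      rw [pairing_negConn_iterate hξ0 hξ, hP, jetDer_sum_mul_eq_pairing (c := c) hξ0 hξ]
    · intro s _ hs
      rw [hPN s (by simpa using hs), iterate_total_zero, mul_zero]
  have hterm : ∀ s k, s + 1 < k → (negConn D c)^[s + 1] (jetSeq D c μ Q (s + 1)) k = 0 :=
    fun s k hk => (negConn_iterate_of_lt (hseq s) _).1 k hk
  have hzero_term : ∀ k, jetSeq D c μ Q 0 (k + 2) = 0 := fun k => rfl
  -- Descending induction on the jet order. In the coefficient of z^{s+2} the terms of lower jet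
  -- order have too small a degree in z (the term of order 0 has degree at most one), and those of
  -- higher order vanish by induction. What remains is ± C_{v_x}^{s+2} ∂Q/∂v^{μ,s+2}.
  have hhigh : ∀ k s, N ≤ s + 2 + k → ∀ ν, jetDer D μ (s + 2) (Q ν) = 0 := by
    intro k
    induction k with
    | zero => exact fun s hs => hNQ _ hs
    | succ k ih =>
      intro s hs
      by_cases hsN : N ≤ s + 2
      · exact hNQ _ hsN
      have h1 : Z (s + 2) = (negConn D c)^[s + 2] (jetSeq D c μ Q (s + 2)) (s + 2) := by
        rw [hZ, Finset.sum_apply, Finset.sum_eq_single (s + 2)]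
        · intro t _ ht
          rcases lt_or_gt_of_ne ht with h | h
          · cases t with
            | zero => exact hzero_term s
            | succ t => exact hterm t _ h
          · obtain ⟨t, rfl⟩ : ∃ t', t = t' + 1 + 2 := ⟨t - 3, by omega⟩
            have : jetSeq D c μ Q (t + 1 + 2) = 0 := by
              refine hseqN (t + 2) fun ν => ?_
              by_cases ht : N ≤ t + 1 + 2
              · exact hNQ _ ht ν
              · exact ih (t + 1) (by omega) ν
            rw [this, Function.iterate_fixed (negConn_zero D c)]
            rfl
        · intro h
          simp at h
          omega
      rw [hZ0, (negConn_iterate_of_lt (hseq (s + 1)) _).2, hseq0] at h1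
      have h2 : firstJetMatrix c ^ (s + 2) *ᵥ (fun ν => jetDer D μ (s + 2) (Q ν)) = 0 := by
        rcases neg_one_pow_eq_or (MvPolynomial (ι × ℕ) K) (s + 2) with h | h <;>
        · rw [h] at h1
          simpa using h1.symm
      exact fun ν => congrFun (eq_zero_of_firstJetMatrix_pow_mulVec_eq_zero hunit _ h2) ν
  have hhigh' : ∀ s ν, jetDer D μ (s + 2) (Q ν) = 0 := fun s ν => hhigh N s (by omega) ν
  have hZeq : Z = negConn D c (jetSeq D c μ Q 1) + jetSeq D c μ Q 0 := by
    rw [hZ, hN, Finset.sum_range_succ', Finset.sum_range_succ', Finset.sum_eq_zero, zero_add]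
    · rfl
    · intro s _
      rw [hseqN (s + 1) (hhigh' s), Function.iterate_fixed (negConn_zero D c)]
  refine ⟨hhigh', fun ν => ?_, ?_⟩
  · have h := congrFun (hZ0 0) ν
    rw [hZeq] at h
    simp only [Pi.add_apply, negConn, hseq0, Pi.zero_apply] at h
    linear_combination h
  · have h := hZ0 1
    rw [hZeq] at h
    funext ν
    have h' := congrFun h ν
    simp only [Pi.add_apply, negConn, hseq0, hseq, Pi.zero_apply, map_zero] at h'
    rw [show jetSeq D c μ Q 0 1 = mulMatrix c μ *ᵥ Q from rfl] at h'
    linear_combination h'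

/-- If all densities `∑_ν (v_x · w)^ν ξ_{a,q,ν}` have zero variational derivatives, then `w` is a
function without jets whose derivative is multiplication by its derivative along the unit. -/
theorem eq_C_of_varDer_pairing_eq_zero [DecidableEq ι] {o : ι}
    (hunit : ∀ ν γ, c ν γ o = if ν = γ then 1 else 0)
    (hcomm : ∀ μ δ ν γ, ∑ ρ, c ν ρ μ * c ρ γ δ = ∑ ρ, c ν ρ δ * c ρ γ μ)
    (hDo : ∀ ν γ μ, D o (c ν γ μ) = 0)
    (hξ0 : ∀ a μ ν, D μ (ξ a 0 ν) = 0)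
    (hξ : ∀ a q μ ν, D μ (ξ a (q + 1) ν) = ∑ ρ, c ρ ν μ * ξ a q ρ)
    (hnd : ∀ y : ι → MvPolynomial (ι × ℕ) K, (∀ a, ∑ ν, y ν * C (ξ a 0 ν) = 0) → y = 0)
    {w : ι → MvPolynomial (ι × ℕ) K}
    (hw : ∀ a q μ, varDer D μ (∑ ν, (firstJetMatrix c *ᵥ w) ν * C (ξ a q ν)) = 0) :
    (∀ γ, w γ = C (coeff 0 (w γ))) ∧
      ∀ μ ν, D μ (coeff 0 (w ν)) = ∑ γ, c ν γ μ * D o (coeff 0 (w γ)) := by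
  obtain ⟨Q, hQ⟩ : ∃ Q, Q = firstJetMatrix c *ᵥ w := ⟨_, rfl⟩
  rw [← hQ] at hw
  have hfo := fun μ => firstOrder_of_varDer_pairing_eq_zero hunit hξ0 hξ hnd
    (μ := μ) fun a q => hw a q μ
  have hjet2 : ∀ μ s γ, jetDer D μ (s + 2) (w γ) = 0 := by
    intro μ s
    suffices (fun γ => jetDer D μ (s + 2) (w γ)) = 0 from fun γ => congrFun this γ
    refine eq_zero_of_firstJetMatrix_mulVec_eq_zero hunit (funext fun ν => ?_)
    rw [Pi.zero_apply, ← (hfo μ).1 s ν, hQ, firstJetMatrix_mulVec, firstJetMatrix_mulVec, map_sum]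
    refine Finset.sum_congr rfl fun δ _ => ?_
    simp [Derivation.leibniz, jetDer_succ_X]
  have hjet1 : ∀ μ, (fun ν => jetDer D μ 1 (Q ν)) =
      mulMatrix c μ *ᵥ w + firstJetMatrix c *ᵥ fun γ => jetDer D μ 1 (w γ) := by
    intro μ
    funext ν
    rw [hQ, Pi.add_apply, firstJetMatrix_mulVec, firstJetMatrix_mulVec, map_sum, mulMatrix_mulVec]
    simp only [Derivation.leibniz, jetDer_succ_X, map_sum, jetDer_succ_C, smul_eq_mul, mul_zero,
      add_zero, Finset.sum_add_distrib, Prod.mk.injEq, and_true, mul_ite, mul_one,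
      Finset.sum_ite_eq', Finset.mem_univ, if_true]
    rw [add_comm]
  have hjet1w : ∀ μ γ, jetDer D μ 1 (w γ) = 0 := by
    intro μ
    suffices (fun γ => jetDer D μ 1 (w γ)) = 0 from fun γ => congrFun this γ
    -- Commutativity cancels C_μ C_{v_x} w on both sides of the first order equation and leaves
    -- C_{v_x}² ∂w/∂v^{μ,1} = 0.
    refine eq_zero_of_firstJetMatrix_pow_mulVec_eq_zero hunit 2 ?_
    have h := (hfo μ).2.2
    rw [hjet1, mulVec_add, hQ, mulVec_mulVec, mulVec_mulVec, mulVec_mulVec,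
      mulMatrix_mul_firstJetMatrix hcomm, left_eq_add] at h
    rw [pow_two]
    exact h
  have hwC : ∀ γ, w γ = C (coeff 0 (w γ)) := fun γ =>
    eq_C_of_pderiv_eq_zero fun j => by
      rw [← jetDer_succ D]
      rcases j with ⟨μ, _ | s⟩
      · exact hjet1w μ γ
      · exact hjet2 μ s γ
  refine ⟨hwC, fun μ ν => ?_⟩
  obtain ⟨f, hf⟩ : ∃ f : ι → K, f = fun γ => coeff 0 (w γ) := ⟨_, rfl⟩
  have hwf : ∀ γ, w γ = C (f γ) := fun γ => by rw [hf]; exact hwC γ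
  have hQC : Q ν = ∑ δ, X (δ, 0) * C (∑ γ, c ν γ δ * f γ) := by
    rw [hQ, firstJetMatrix_mulVec]
    simp only [hwf, map_sum, map_mul]
  have h1 : jetDer D μ 1 (Q ν) = C (∑ γ, c ν γ μ * f γ) := by
    rw [hQC, map_sum]
    simp only [Derivation.leibniz, jetDer_succ_C, jetDer_succ_X]
    simp
  have h2 := (hfo μ).2.1 ν
  rw [h1, total_C, hQC, map_sum, ← sub_eq_zero, ← Finset.sum_sub_distrib] at h2
  have h3 : ∑ δ, (X (δ, 0) : MvPolynomial (ι × ℕ) K) *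
      C (D μ (∑ γ, c ν γ δ * f γ) - D δ (∑ γ, c ν γ μ * f γ)) = 0 := by
    rw [← h2]
    refine Finset.sum_congr rfl fun δ _ => ?_
    rw [Derivation.leibniz, jetDer_zero_C, jetDer_zero_X, smul_zero, add_zero, smul_eq_mul,
      map_sub, mul_sub]
  -- The coefficient of v^δ_x reads ∂_μ(C_δ w) = ∂_δ(C_μ w). Taking δ along the unit gives ∂_μ w =
  -- C_μ ∂_o w, as C_o = 1 and ∂_o kills the structure functions.
  have h4 := eq_zero_of_sum_X_mul_C_eq_zero h3 o
  rw [sub_eq_zero] at h4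
  have h5 : ∑ γ, c ν γ o * f γ = f ν := by simp [hunit]
  rw [h5] at h4
  rw [← congrFun hf ν, h4, map_sum]
  refine Finset.sum_congr rfl fun γ _ => ?_
  rw [Derivation.leibniz, hDo, smul_zero, add_zero, smul_eq_mul, hf]

end Symmetry

end JetAlgebra

/-! ### From the gradient equation to deformed flat coordinates. -/

namespace JetAlgebra

open MvPolynomial Matrix

variable {ι K : Type*} [Fintype ι] [DecidableEq ι] [CommRing K] [Algebra ℂ K]
  {D : ι → Derivation ℂ K K}

/-- Solutions of `∂_λ ∂_μ f = c^ν_{λμ} ∂_ν ∂_o f` that are polynomial along the unit are linear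
combinations of deformed flat coordinates and constants. -/
theorem exists_mem_span_of_pde {J : Type*} {c : ι → ι → ι → K} {θ : J × ℕ → K} {x : ι → K} {o : ι}
    (hD : ∀ α β a, D α (D β a) = D β (D α a))
    (hconst : ∀ a, (∀ α, D α a = 0) → ∃ k, a = algebraMap ℂ K k)
    (hDo : ∀ ν γ μ, D o (c ν γ μ) = 0)
    (hx : ∀ α β, D α (x β) = if α = β then 1 else 0)
    (hxθ : ∀ β, x β ∈ Submodule.span ℂ (Set.range θ))
    (hθ : ∀ a p l m, D l (D m (θ (a, p + 1))) = ∑ ν, c ν l m * D ν (θ (a, p)))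
    (N : ℕ) {f : K} (hf : ∀ l m, D l (D m f) = ∑ ν, c ν l m * D ν (D o f))
    (hN : (D o)^[N] f = 0) :
    ∃ s ∈ Submodule.span ℂ (Set.range θ), ∃ k, f = s + algebraMap ℂ K k := by
  induction N generalizing f with
  | zero => exact ⟨0, zero_mem _, 0, by simpa using hN⟩
  | succ N ih =>
    -- The structure functions do not depend on the unit coordinate, so D o f solves the same
    -- system.
    obtain ⟨s, hs, k, hsk⟩ := ih (f := D o f) (fun l m => by
      rw [hD m o, hD l o, hf, map_sum]
      refine Finset.sum_congr rfl fun ν _ => ?_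
      rw [Derivation.leibniz, hDo, smul_zero, add_zero, smul_eq_mul, hD o ν]) hN
    -- t arises from s by the shift θ_{a,p} → θ_{a,p+1}. Then f - t has zero second derivatives, so
    -- it is affine, and the coordinates lie in the span.
    obtain ⟨t, ht, hts⟩ : ∃ t ∈ Submodule.span ℂ (Set.range θ),
        ∀ l m, D l (D m t) = ∑ ν, c ν l m * D ν s := by
      clear hsk
      induction hs using Submodule.span_induction with
      | mem y hy =>
        obtain ⟨⟨a, p⟩, rfl⟩ := hy
        exact ⟨_, Submodule.subset_span ⟨(a, p + 1), rfl⟩, hθ a p⟩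
      | zero => exact ⟨0, zero_mem _, fun l m => by simp⟩
      | add y z _ _ hy hz =>
        obtain ⟨t, ht, hty⟩ := hy
        obtain ⟨u, hu, huz⟩ := hz
        exact ⟨t + u, add_mem ht hu, fun l m => by
          simp only [map_add, hty, huz, mul_add, Finset.sum_add_distrib]⟩
      | smul r y _ hy =>
        obtain ⟨t, ht, hty⟩ := hy
        exact ⟨r • t, Submodule.smul_mem _ r ht, fun l m => by
          simp only [Derivation.map_smul, hty, Finset.smul_sum, mul_smul_comm]⟩
    have h1 : ∀ m l, D l (D m (f - t)) = 0 := by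
      intro m l
      rw [map_sub, map_sub, hf, hts, hsk]
      simp
    choose κ hκ using fun m => hconst (D m (f - t)) (h1 m)
    obtain ⟨k', hk'⟩ := hconst (f - t - ∑ β, κ β • x β) fun α => by
      rw [map_sub, hκ, map_sum]
      simp [hx, Algebra.smul_def]
    refine ⟨t + ∑ β, κ β • x β, add_mem ht (Submodule.sum_mem _ fun β _ =>
      Submodule.smul_mem _ _ (hxθ β)), k', ?_⟩
    rw [← hk']
    ring

theorem derivation_iterate_pow_mul {R A : Type*} [CommSemiring R] [CommSemiring A] [Algebra R A]
    (d : Derivation R A A) {x : A} (hx : d x = 1) {m k : ℕ} (hk : k < m) {b : A} (hb : d b = 0) :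
    d^[m] (x ^ k * b) = 0 := by
  induction m generalizing k b with
  | zero => omega
  | succ m ih =>
    rw [Function.iterate_succ_apply, Derivation.leibniz, hb, smul_zero, zero_add,
      Derivation.leibniz_pow, hx]
    cases k with
    | zero =>
      rw [zero_smul, smul_zero]
      exact Function.iterate_fixed (map_zero _) m
    | succ k =>
      have h1 : b • (k + 1) • (x ^ (k + 1 - 1) • (1 : A)) = x ^ k * ((k + 1) • b) := by
        simp only [smul_eq_mul, nsmul_eq_mul, Nat.add_sub_cancel]
        ring
      rw [h1]
      exact ih (by omega) (by rw [map_nsmul, hb, smul_zero])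

theorem coeff_zero_total (f : MvPolynomial (ι × ℕ) K) : coeff 0 (total D f) = 0 := by
  rw [total_apply D f subset_rfl, coeff_add, coeff_sum, coeff_sum, Finset.sum_eq_zero,
    Finset.sum_eq_zero, add_zero]
  · intro j _
    rw [coeff_X_mul']
    simp
  · intro j _
    rw [coeff_X_mul']
    simp

/-- Total derivatives have no jet-free part, so only the term s = 0 survives. A variational gradient
free of jets is therefore the differential of the jet-free part of the density. -/
theorem coeff_zero_varDer (α : ι) (f : MvPolynomial (ι × ℕ) K) :
    coeff 0 (varDer D α f) = D α (coeff 0 f) := by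
  rw [varDer, Finset.sum_range_succ', coeff_add, coeff_sum, Finset.sum_eq_zero]
  · simp [jetDer_zero, coeff_coeffDer]
  · intro s _
    rw [Function.iterate_succ_apply', show ((-1) ^ (s + 1) : MvPolynomial (ι × ℕ) K) =
      C ((-1) ^ (s + 1)) by simp, coeff_C_mul, coeff_zero_total, mul_zero]

/-- Conservation laws of the Principal Hierarchy, for the ring of functions `K` with the
derivations `D` along flat coordinates `x`. -/
theorem exists_eq_of_conservationLaw {o : ι} {η : Matrix ι ι ℂ} {F : K} {x : ι → K}
    {c : ι → ι → ι → K} {θ : ι → ℕ → K}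
    (hD : ∀ α β a, D α (D β a) = D β (D α a))
    (hconst : ∀ a, (∀ α, D α a = 0) → ∃ k, a = algebraMap ℂ K k)
    (hclosed : ∀ κ : ι → K, (∀ α β, D α (κ β) = D β (κ α)) → ∃ a, ∀ α, D α a = κ α)
    (hx : ∀ α β, D α (x β) = if α = β then 1 else 0)
    (hηs : η.IsSymm) (hη : IsUnit η.det)
    (hunity : ∀ α β, D o (D α (D β F)) = algebraMap ℂ K (η α β))
    (hassoc : ∀ α β γ δ, ∑ l, ∑ m, η⁻¹ l m • (D α (D β (D l F)) * D m (D γ (D δ F))) =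
      ∑ l, ∑ m, η⁻¹ l m • (D δ (D β (D l F)) * D m (D γ (D α F))))
    (hc : ∀ γ α β, c γ α β = ∑ ε, η⁻¹ γ ε • D ε (D α (D β F)))
    (hθ0 : ∀ α, θ α 0 = ∑ ε, η α ε • x ε)
    (hθ : ∀ α p l m, D l (D m (θ α (p + 1))) = ∑ ν, c ν l m * D ν (θ α p))
    {h : MvPolynomial (ι × ℕ) K}
    (hcons : ∀ a p μ, varDer D μ (∑ α, ∑ β, C (algebraMap ℂ K (η⁻¹ α β)) *
      (varDer D α h * total D (varDer D β (C (θ a p))))) = 0)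
    {N : ℕ} (hN : (D o)^[N] (coeff 0 h) = 0) :
    ∃ s ∈ Submodule.span ℂ (Set.range fun i : ι × ℕ => θ i.1 i.2), ∃ B k,
      h = C s + total D B + C (algebraMap ℂ K k) := by
  have hηinv : ∀ α γ, ∑ β, η⁻¹ α β * η β γ = if α = γ then 1 else 0 := fun α γ => by
    rw [← Matrix.mul_apply, Matrix.nonsing_inv_mul _ hη, Matrix.one_apply]
  have hηinv' : ∀ α γ, ∑ β, η α β * η⁻¹ β γ = if α = γ then 1 else 0 := fun α γ => by
    rw [← Matrix.mul_apply, Matrix.mul_nonsing_inv _ hη, Matrix.one_apply]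
  have hηs' : ∀ α β, η⁻¹ α β = η⁻¹ β α := fun α β => by
    have : (η⁻¹)ᵀ = η⁻¹ := by rw [Matrix.transpose_nonsing_inv, hηs]
    exact congrFun (congrFun this β) α
  have hcsymm : ∀ ν γ δ, c ν γ δ = c ν δ γ := fun ν γ δ => by simp only [hc, hD γ δ]
  have hunit : ∀ ν γ, c ν γ o = if ν = γ then 1 else 0 := by
    intro ν γ
    have h1 : ∀ ε, D ε (D γ (D o F)) = algebraMap ℂ K (η ε γ) := fun ε => by
      rw [hD γ o, hD ε o, hunity]
    simp only [hc, h1, Algebra.smul_def, ← map_mul, ← map_sum, hηinv]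
    split_ifs <;> simp
  have hDo : ∀ ν γ μ, D o (c ν γ μ) = 0 := by
    intro ν γ μ
    rw [hc, map_sum]
    refine Finset.sum_eq_zero fun ε _ => ?_
    rw [Derivation.map_smul, hD o ε, hunity, Derivation.map_algebraMap, smul_zero]
  -- The associativity equations are exactly the symmetry in μ and δ of the expression in `hexp`.
  have hcomm : ∀ μ δ ν γ, ∑ ρ, c ν ρ μ * c ρ γ δ = ∑ ρ, c ν ρ δ * c ρ γ μ := by
    have hexp : ∀ μ δ ν γ, ∑ ρ, c ν ρ μ * c ρ γ δ = ∑ ε, η⁻¹ ν ε •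
        ∑ l, ∑ m, η⁻¹ l m • (D μ (D ε (D l F)) * D m (D γ (D δ F))) := by
      intro μ δ ν γ
      simp only [hc ν, Finset.sum_mul, Finset.smul_sum]
      rw [Finset.sum_comm]
      refine Finset.sum_congr rfl fun ε _ => Finset.sum_congr rfl fun l _ => ?_
      rw [hc, Finset.mul_sum]
      refine Finset.sum_congr rfl fun m _ => ?_
      rw [hD μ ε, hD μ l, smul_mul_assoc, mul_smul_comm]
    intro μ δ ν γ
    rw [hexp, hexp]
    simp only [hassoc μ]
  obtain ⟨ξ, hξdef⟩ : ∃ ξ : ι → ℕ → ι → K, ∀ a q ν, ξ a q ν = D ν (θ a q) :=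
    ⟨_, fun _ _ _ => rfl⟩
  have hξ0' : ∀ a ν, ξ a 0 ν = algebraMap ℂ K (η a ν) := by
    intro a ν
    simp only [hξdef, hθ0, map_sum, Derivation.map_smul, hx]
    simp [Algebra.smul_def]
  have hξ0 : ∀ a μ ν, D μ (ξ a 0 ν) = 0 := fun a μ ν => by
    rw [hξ0', Derivation.map_algebraMap]
  have hξ : ∀ a q μ ν, D μ (ξ a (q + 1) ν) = ∑ ρ, c ρ ν μ * ξ a q ρ := fun a q μ ν => by
    simp only [hξdef, hθ, hcsymm _ ν μ]
  have hinvert : ∀ y : ι → MvPolynomial (ι × ℕ) K, ∀ ν,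
      ∑ α, C (algebraMap ℂ K (η⁻¹ ν α)) * ∑ β, y β * C (algebraMap ℂ K (η α β)) = y ν := by
    intro y ν
    simp only [Finset.mul_sum]
    rw [Finset.sum_comm]
    calc _ = ∑ β, y β * C (algebraMap ℂ K (∑ α, η⁻¹ ν α * η α β)) := by
          refine Finset.sum_congr rfl fun β _ => ?_
          simp only [map_sum, map_mul, Finset.mul_sum]
          refine Finset.sum_congr rfl fun α _ => ?_
          ring
      _ = y ν := by
          rw [Finset.sum_eq_single_of_mem ν (Finset.mem_univ ν)]
          · simp [hηinv]
          · intro β _ hβ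
            simp [hηinv, hβ.symm]
  have hnd : ∀ y : ι → MvPolynomial (ι × ℕ) K,
      (∀ a, ∑ ν, y ν * C (ξ a 0 ν) = 0) → y = 0 := by
    intro y hy
    funext ν
    rw [← hinvert y ν]
    simp only [hξ0'] at hy
    simp [hy]
  obtain ⟨w, hw⟩ : ∃ w : ι → MvPolynomial (ι × ℕ) K,
      ∀ β, w β = ∑ α, C (algebraMap ℂ K (η⁻¹ α β)) * varDer D α h := ⟨_, fun _ => rfl⟩
  -- Only the brackets with index q + 1 enter: for them the recursion expresses the x-derivative of
  -- the gradient of θ_{a,q+1} as v_x times the gradient of θ_{a,q}.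
  have hwQ : ∀ a q, ∑ α, ∑ β, C (algebraMap ℂ K (η⁻¹ α β)) *
      (varDer D α h * total D (varDer D β (C (θ a (q + 1))))) =
      ∑ ν, (firstJetMatrix c *ᵥ w) ν * C (ξ a q ν) := by
    intro a q
    have h1 : ∀ β, total D (varDer D β (C (θ a (q + 1)))) =
        ∑ ν, ∑ δ, X (δ, 0) * (C (c ν β δ) * C (ξ a q ν)) := by
      intro β
      rw [varDer_C, total_C, Finset.sum_comm]
      refine Finset.sum_congr rfl fun δ _ => ?_
      rw [hθ, map_sum, Finset.mul_sum]
      refine Finset.sum_congr rfl fun ν _ => ?_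
      rw [map_mul, hcsymm, hξdef]
    have h2 : ∑ α, ∑ β, C (algebraMap ℂ K (η⁻¹ α β)) *
        (varDer D α h * total D (varDer D β (C (θ a (q + 1))))) =
        ∑ β, w β * total D (varDer D β (C (θ a (q + 1)))) := by
      rw [Finset.sum_comm]
      refine Finset.sum_congr rfl fun β _ => ?_
      rw [hw, Finset.sum_mul]
      refine Finset.sum_congr rfl fun α _ => ?_
      ring
    rw [h2]
    simp only [h1, firstJetMatrix_mulVec, Finset.mul_sum, Finset.sum_mul]
    rw [Finset.sum_comm]
    refine Finset.sum_congr rfl fun ν _ => ?_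
    rw [Finset.sum_comm]
    refine Finset.sum_congr rfl fun δ _ => Finset.sum_congr rfl fun β _ => ?_
    ring
  obtain ⟨hwC, hpde⟩ := eq_C_of_varDer_pairing_eq_zero (D := D) hunit hcomm hDo hξ0 hξ hnd
    (w := w) fun a q μ => by rw [← hwQ]; exact hcons a (q + 1) μ
  obtain ⟨f, hf⟩ : ∃ f, f = coeff 0 h := ⟨_, rfl⟩
  have hwf : ∀ γ, coeff 0 (w γ) = ∑ α, η⁻¹ α γ • D α f := by
    intro γ
    rw [hw, coeff_sum]
    simp only [coeff_C_mul, coeff_zero_varDer, hf, Algebra.smul_def]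
  have hvar : ∀ α, varDer D α h = C (D α f) := by
    intro α
    have h1 : ∑ β, C (algebraMap ℂ K (η α β)) * w β = varDer D α h := by
      simp only [hw, Finset.mul_sum]
      rw [Finset.sum_comm]
      calc _ = ∑ γ, C (algebraMap ℂ K (∑ β, η α β * η⁻¹ β γ)) * varDer D γ h := by
            refine Finset.sum_congr rfl fun γ _ => ?_
            simp only [map_sum, map_mul, Finset.sum_mul, hηs' γ]
            refine Finset.sum_congr rfl fun β _ => ?_
            ring
        _ = varDer D α h := by
            rw [Finset.sum_eq_single_of_mem α (Finset.mem_univ α)]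
            · simp [hηinv']
            · intro β _ hβ
              simp [hηinv', hβ.symm]
    have h2 : varDer D α h = C (∑ β, algebraMap ℂ K (η α β) * coeff 0 (w β)) := by
      rw [← h1, map_sum]
      refine Finset.sum_congr rfl fun β _ => ?_
      rw [map_mul, ← hwC]
    have h3 := coeff_zero_varDer (D := D) α h
    rw [h2, coeff_zero_C] at h3
    rw [h2, h3, hf]
  obtain ⟨B, k₁, hB⟩ := exists_eq_total_add_const_of_varDer_eq_zero D hD hconst hclosed
    (g := h - C f) fun α => by
      have h1 := varDer_add D α (h - C f) (C f)
      rw [sub_add_cancel, hvar, varDer_C] at h1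
      exact left_eq_add.1 (by rw [add_comm]; exact h1)
  -- Lowering the index of ∂_l w = C_l ∂_o w; the symmetry of the third derivatives of F moves η
  -- across C_l.
  have hfpde : ∀ l m, D l (D m f) = ∑ ν, c ν l m * D ν (D o f) := by
    intro l m
    have h1 : D m f = ∑ ν, η m ν • coeff 0 (w ν) := by
      have h0 : ∀ γ, coeff 0 (w γ) = ∑ α, η⁻¹ γ α • D α f := fun γ => by
        rw [hwf]
        exact Finset.sum_congr rfl fun α _ => by rw [hηs']
      simp only [h0, Finset.smul_sum, smul_smul]
      rw [Finset.sum_comm]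
      simp only [← Finset.sum_smul, hηinv']
      simp
    have h2 : ∀ γ, ∑ ν, η m ν • c ν γ l = D γ (D l (D m F)) := by
      intro γ
      simp only [hc, Finset.smul_sum, smul_smul]
      rw [Finset.sum_comm]
      simp only [← Finset.sum_smul, hηinv']
      simp only [ite_smul, one_smul, zero_smul, Finset.sum_ite_eq, Finset.mem_univ, if_true]
      rw [hD m γ, hD m l]
    rw [h1, map_sum]
    calc _ = ∑ ν, ∑ γ, (η m ν • c ν γ l) * D o (coeff 0 (w γ)) := by
          refine Finset.sum_congr rfl fun ν _ => ?_
          rw [Derivation.map_smul, hpde, Finset.smul_sum]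
          simp only [smul_mul_assoc]
      _ = ∑ γ, D γ (D l (D m F)) * ∑ ν, η⁻¹ ν γ • D ν (D o f) := by
          rw [Finset.sum_comm]
          refine Finset.sum_congr rfl fun γ _ => ?_
          rw [← Finset.sum_mul, h2, hwf, map_sum]
          simp only [Derivation.map_smul, hD o]
      _ = _ := by
          simp only [hc, Finset.mul_sum, Finset.sum_mul]
          rw [Finset.sum_comm]
          simp only [mul_smul_comm, smul_mul_assoc]
  rw [← hf] at hN
  obtain ⟨s, hs, k₂, hsk⟩ := exists_mem_span_of_pde (c := c)
    (θ := fun i : ι × ℕ => θ i.1 i.2) (x := x) hD hconst hDo hx (fun β => by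
      have h1 : x β = ∑ α, η⁻¹ β α • θ α 0 := by
        simp only [hθ0, Finset.smul_sum, smul_smul]
        rw [Finset.sum_comm]
        simp only [← Finset.sum_smul, hηinv]
        simp
      rw [h1]
      exact Submodule.sum_mem _ fun α _ => Submodule.smul_mem _ _
        (Submodule.subset_span ⟨(α, 0), rfl⟩)) hθ N hfpde hN
  refine ⟨s, hs, B, k₁ + k₂, ?_⟩
  rw [hsk, map_add] at hB
  rw [map_add, map_add]
  linear_combination hB

end JetAlgebra

/-! ### Specialization of the algebraic result to holomorphic functions. -/

namespace PrincipalHierarchy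

open TopologicalSpace (Opens)

section Bridge

variable {n : ℕ} {U : Opens (Fin n → ℂ)}

theorem jetPd_eq_jetDer (α : Fin n) (s : ℕ) (f : DiffPoly U) :
    jetPd α s f = JetAlgebra.jetDer (pdDer (U := U)) α s f := by
  cases s <;> rfl

theorem totalDeriv_eq_total (f : DiffPoly U) :
    totalDeriv f = JetAlgebra.total (pdDer (U := U)) f := by
  rw [JetAlgebra.total_apply _ f subset_rfl, totalDeriv]
  simp only [jetPd_eq_jetDer]

theorem varDeriv_eq_varDer (α : Fin n) (f : DiffPoly U) :
    varDeriv α f = JetAlgebra.varDer (pdDer (U := U)) α f := by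
  rw [varDeriv, JetAlgebra.varDer, show (totalDeriv : DiffPoly U → DiffPoly U) =
    JetAlgebra.total (pdDer (U := U)) from funext totalDeriv_eq_total]
  simp only [jetPd_eq_jetDer]
  rfl

theorem varDer_eq_zero_of_isZeroFunctional (α : Fin n) {f : DiffPoly U}
    (hf : IsZeroFunctional f) : JetAlgebra.varDer (pdDer (U := U)) α f = 0 := by
  obtain ⟨g, k, rfl⟩ := hf
  rw [totalDeriv_eq_total, JetAlgebra.varDer_add, JetAlgebra.varDer_total _ pd_comm, zero_add]
  exact JetAlgebra.varDer_const _ α k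

/-- The jet-free part of h has degree less than N in v^1, so N derivatives along v^1 annihilate it.
-/
theorem exists_pdDer_iterate_coeff_eq_zero [NeZero n] {h : DiffPoly U}
    (hpoly : IsPolynomialInFirst h) :
    ∃ N, (pdDer (0 : Fin n))^[N] (MvPolynomial.coeff 0 h) = 0 := by
  obtain ⟨N, a, ha, rfl⟩ := hpoly
  refine ⟨N, ?_⟩
  rw [MvPolynomial.coeff_sum]
  refine Finset.sum_induction _ (fun f => (pdDer (0 : Fin n))^[N] f = 0)
    (fun f g hf hg => by rw [iterate_map_add, hf, hg, add_zero])
    (Function.iterate_fixed (map_zero _) N) fun k hk => ?_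
  rw [ofFun, ← map_pow, MvPolynomial.coeff_C_mul]
  refine JetAlgebra.derivation_iterate_pow_mul (pdDer 0) ?_ (Finset.mem_range.1 hk) ?_
  · rw [pdDer_apply, pd_coord, if_pos rfl, map_one]
  · have h1 : JetAlgebra.coeffDer (pdDer 0) (a k) = 0 := ha k
    rw [← JetAlgebra.coeff_coeffDer, h1, MvPolynomial.coeff_zero]

end Bridge

end PrincipalHierarchy

end

theorem mainTheorem11 (n : ℕ) [NeZero n] (U : TopologicalSpace.Opens (Fin n → ℂ))
    [SimplyConnectedSpace U] (M : PrincipalHierarchy.FrobeniusManifold n U)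
    (hM : M.IsSemisimple) (L : PrincipalHierarchy.LeveltSystem M)
    (h : PrincipalHierarchy.DiffPoly U)
    (hcons : PrincipalHierarchy.IsConservationLaw L h)
    (hpoly : PrincipalHierarchy.IsPolynomialInFirst h) :
    ∃ (c : Fin n × ℕ →₀ ℂ) (g : PrincipalHierarchy.DiffPoly U) (k : ℂ),
      h = c.sum (fun i a => PrincipalHierarchy.ofFun (a • L.θ i.1 i.2))
        + PrincipalHierarchy.totalDeriv g + PrincipalHierarchy.ofConst k := by
  open PrincipalHierarchy in
  obtain ⟨N, hN⟩ := exists_pdDer_iterate_coeff_eq_zero hpoly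
  obtain ⟨s, hs, B, k, hB⟩ := JetAlgebra.exists_eq_of_conservationLaw
    (D := pdDer (U := U)) (o := 0) (η := M.η) (F := M.F) (x := coord) (c := M.c) (θ := L.θ)
    pd_comm exists_eq_algebraMap_of_pd_eq_zero exists_pd_eq_of_closed
    (fun α β => by rw [pdDer_apply, pd_coord]; split_ifs <;> simp)
    M.η_symm M.η_nondeg M.unity M.assoc (fun _ _ _ => rfl) L.θ_zero L.θ_succ
    (h := h) (fun a p μ => by
      have h1 := varDer_eq_zero_of_isZeroFunctional μ (hcons a p)
      rw [bracketDensity] at h1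
      simp only [varDeriv_eq_varDer, totalDeriv_eq_total] at h1
      exact h1) hN
  obtain ⟨c, rfl⟩ := Finsupp.mem_span_range_iff_exists_finsupp.1 hs
  refine ⟨c, B, k, ?_⟩
  rw [totalDeriv_eq_total, hB]
  congr 2
  rw [map_finsuppSum]
  rfl
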